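/- Let $p\ge 1$ be an integer. For $i=1,2$ let $\gamma_i\subset\mathbb C$ be a simple closed contour of class $C^p$ (with a regular parametrization), positively oriented, and let $D_i^+$ be the bounded domain that it encloses. Let $G_i\subset\mathbb C$ be a connected set containing $\gamma_i\cup D_i^+$ (for instance a closed bounded domain that contains $\gamma_i$ and $D_i^+$ in its interior), and put $G=G_1\times G_2$. A function is called analytic in $G$ if it is analytic (holomorphic in both variables) in a neighbourhood of every point of $G$. Let $a,b,c,d,f$ be analytic in $G$. For a function $\varphi$ on a contour $\gamma$ and $t\in\gamma$, the hypersingular integral is understood in the Cauchy–Hadamard sense: $$\int_\gamma\frac{\varphi(\tau)\,d\tau}{(\tau-t)^p}=\lim_{\varepsilon\to0+}\left[\int_{\gamma\cap\{|\tau-t|\ge\varepsilon\}}\frac{\varphi(\tau)\,d\tau}{(\tau-t)^p}+\frac{\xi(\varepsilon)}{\varepsilon^{p-1}}\right],$$ where $\xi$ is a polynomial of degree less than $p-1$ ($\xi=0$ if $p=1$) for which the limit exists. The bihypersingular integral over $\gamma_1\times\gamma_2$ is the iterated hypersingular integral (first over $\gamma_2$, then over $\gamma_1$). Let $x$ be analytic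 in $G$. Consider the bihypersingular integral equation $$a(t_1,t_2)x(t_1,t_2)+\frac{b(t_1,t_2)}{\pi i}\int_{\gamma_1}\frac{x(\tau_1,t_2)\,d\tau_1}{(\tau_1-t_1)^p}+\frac{c(t_1,t_2)}{\pi i}\int_{\gamma_2}\frac{x(t_1,\tau_2)\,d\tau_2}{(\tau_2-t_2)^p}-\frac{d(t_1,t_2)}{\pi^2}\int_{\gamma_1}\int_{\gamma_2}\frac{x(\tau_1,\tau_2)\,d\tau_2\,d\tau_1}{(\tau_1-t_1)^p(\tau_2-t_2)^p}=f(t_1,t_2)\tag{6.1}$$ for all $(t_1,t_2)\in\gamma_1\times\gamma_2$ (the existence of the integrals being part of the equation), and the linear partial differential equation $$a\,x+\frac{b}{(p-1)!}\frac{\partial^{p-1}x}{\partial t_1^{p-1}}+\frac{c}{(p-1)!}\frac{\partial^{p-1}x}{\partial t_2^{p-1}}+\frac{d}{((p-1)!)^2}\frac{\partial^{2p-2}x}{\partial t_1^{p-1}\,\partial t_2^{p-1}}=f.\tag{6.11}$$ Then $x$ solves (6.1) on $\gamma_1\times\gamma_2$ if and only if $x$ satisfies (6.11) at all points of $\gamma_1\times\gamma_2$,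 and also if and only if $x$ satisfies (6.11) at all points of $G$. -/

import Mathlib

open Set Filter Topology MeasureTheory

noncomputable section

/-- A simple closed contour of class `C^n` in the complex plane, given by a regular `1`-periodic
parametrization. -/
structure ClosedContour (n : ℕ) where
  toFun : ℝ → ℂ
  contDiff : ContDiff ℝ n toFun
  periodic : Function.Periodic toFun 1
  deriv_ne_zero : ∀ s, deriv toFun s ≠ 0
  injOn : Set.InjOn toFun (Set.Ico 0 1)

namespace ClosedContour

/-- The contour as a set of points. -/
def carrier {n : ℕ} (γ : ClosedContour n) : Set ℂ := Set.range γ.toFun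

/-- The inner domain `D⁺`: the points off the contour whose connected component in the complement
of the contour is bounded. -/
def inside {n : ℕ} (γ : ClosedContour n) : Set ℂ :=
  {z | z ∉ γ.carrier ∧ Bornology.IsBounded (connectedComponentIn γ.carrierᶜ z)}

/-- Positive (counterclockwise) orientation: the contour winds once around every inner point. -/
def IsPositivelyOriented {n : ℕ} (γ : ClosedContour n) : Prop :=
  ∀ z ∈ γ.inside, ∫ s in Set.Ico (0 : ℝ) 1, deriv γ.toFun s / (γ.toFun s - z)
    = 2 * Real.pi * Complex.I

/-- The parameters of the part of the contour that remains after removing the points at distance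
less than `ε` from `t`. -/
def cutParams {n : ℕ} (γ : ClosedContour n) (t : ℂ) (ε : ℝ) : Set ℝ :=
  {s | s ∈ Set.Ico (0 : ℝ) 1 ∧ ε ≤ ‖γ.toFun s - t‖}

/-- The integrand of `∫ φ(τ) / (τ - t)^p dτ`, pulled back to the parameter. -/
def hyperIntegrand {n : ℕ} (γ : ClosedContour n) (p : ℕ) (φ : ℂ → ℂ) (t : ℂ) (s : ℝ) : ℂ :=
  φ (γ.toFun s) / (γ.toFun s - t) ^ p * deriv γ.toFun s

/-- The hypersingular integral `∫_γ φ(τ) / (τ - t)^p dτ` exists in the sense of Cauchy and Hadamard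
and has the value `I`: with the points of `γ` at distance less than `ε` from `t` removed, the
integral plus a correction `ξ(ε) / ε^(p-1)` tends to `I` as `ε → 0+`. Here `ξ` is a polynomial of
degree less than `p - 1`, so that the correction consists of negative powers of `ε` only and the
value is unique. For `p = 1` this is the Cauchy principal value. -/
def HasHypersingularIntegral {n : ℕ} (γ : ClosedContour n) (p : ℕ) (φ : ℂ → ℂ) (t I : ℂ) : Prop :=
  (∀ ε : ℝ, 0 < ε → IntegrableOn (γ.hyperIntegrand p φ t) (γ.cutParams t ε)) ∧
  ∃ ξ ∈ Polynomial.degreeLT ℂ (p - 1),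
    Tendsto (fun ε : ℝ => (∫ s in γ.cutParams t ε, γ.hyperIntegrand p φ t s)
      + ξ.eval (ε : ℂ) / (ε : ℂ) ^ (p - 1)) (𝓝[>] 0) (𝓝 I)

end ClosedContour

/-- The bihypersingular integral
`∫_{γ₁} ∫_{γ₂} x(τ₁, τ₂) / ((τ₁ - t₁)^p (τ₂ - t₂)^p) dτ₂ dτ₁`
exists as an iterated hypersingular integral and has the value `I`. -/
def HasBihypersingularIntegral {n : ℕ} (γ₁ γ₂ : ClosedContour n) (p : ℕ) (x : ℂ × ℂ → ℂ)
    (t₁ t₂ I : ℂ) : Prop :=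
  ∃ H : ℂ → ℂ,
    (∀ τ₁ ∈ γ₁.carrier, γ₂.HasHypersingularIntegral p (fun τ₂ => x (τ₁, τ₂)) t₂ (H τ₁)) ∧
    γ₁.HasHypersingularIntegral p H t₁ I

/-- `x` solves the bihypersingular integral equation with coefficients `a, b, c, d` and right-hand
side `f` at every point of `γ₁ × γ₂` (in particular, the integrals exist there). -/
def SolvesBihypersingularEquation {n : ℕ} (γ₁ γ₂ : ClosedContour n) (p : ℕ)
    (a b c d f x : ℂ × ℂ → ℂ) : Prop :=
  ∀ t₁ ∈ γ₁.carrier, ∀ t₂ ∈ γ₂.carrier, ∃ I₁ I₂ I₁₂ : ℂ,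
    γ₁.HasHypersingularIntegral p (fun τ₁ => x (τ₁, t₂)) t₁ I₁ ∧
    γ₂.HasHypersingularIntegral p (fun τ₂ => x (t₁, τ₂)) t₂ I₂ ∧
    HasBihypersingularIntegral γ₁ γ₂ p x t₁ t₂ I₁₂ ∧
    a (t₁, t₂) * x (t₁, t₂) + b (t₁, t₂) / (Real.pi * Complex.I) * I₁
      + c (t₁, t₂) / (Real.pi * Complex.I) * I₂
      - d (t₁, t₂) / (Real.pi : ℂ) ^ 2 * I₁₂ = f (t₁, t₂)

/-- `x` solves the linear partial differential equation
`a x + b/(p-1)! ∂₁^(p-1) x + c/(p-1)! ∂₂^(p-1) x + d/((p-1)!)² ∂₁^(p-1) ∂₂^(p-1) x = f`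
at every point of `S`. -/
def SolvesPDEOn (S : Set (ℂ × ℂ)) (p : ℕ) (a b c d f x : ℂ × ℂ → ℂ) : Prop :=
  ∀ t ∈ S,
    a t * x t
      + b t / ((p - 1).factorial : ℂ) * iteratedDeriv (p - 1) (fun z₁ => x (z₁, t.2)) t.1
      + c t / ((p - 1).factorial : ℂ) * iteratedDeriv (p - 1) (fun z₂ => x (t.1, z₂)) t.2
      + d t / ((p - 1).factorial : ℂ) ^ 2 *
          iteratedDeriv (p - 1) (fun z₁ => iteratedDeriv (p - 1) (fun z₂ => x (z₁, z₂)) t.2) t.1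
      = f t

end

/-! Everything rests on one formula: if `φ` is analytic on a contour `γ` and inside it, then for `t
∈ γ` the hypersingular integral of order `p` is `πi φ⁽ᵖ⁻¹⁾(t) / (p - 1)!`
(`hasHypersingularIntegral_iteratedDeriv`). Writing `φ(τ) = φ(t) + (τ - t) ψ(τ)` with `ψ = dslope φ
t`, again analytic, reduces order `k + 1` for `φ` to order `k` for `ψ` plus `φ(t)` times the
integral of `(τ - t)^(-k-1)`. Three inputs make this recursion explicit:

At order `0` the integral is zero by Cauchy's theorem, proved by Dixon's argument so that nothing is
needed about the topology of the contour.

At order `1` the constant function has principal value `πi`. Near `t`, logarithms compare the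
winding numbers on the two sides of the curve. These differ by `2πi` and lie in `{0, 2πi}`, which
fixes both; the removed arc then accounts for half a turn.

At order `n + 1 ≥ 2` the constant function has integral `0`. The antiderivative `-(τ - t)^(-n) / n`
leaves two end point terms, which have Taylor expansions in the signed distance to `t`. Their
constant terms cancel and the negative powers of `ε` are removed by `ξ`. The smoothness `C^p` of the
contour is used here.

Hence only the value at `t` of the `(p - 1)`-fold slope survives, a Taylor coefficient of `φ`.
Applying the formula in each variable, and twice for the iterated integral, where `(πi)² = -π²`,
turns the integral equation into the differential equation on `γ₁ × γ₂`; uniqueness of finite parts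
makes this an equivalence. The identity theorem, one variable at a time, extends the differential
equation to `G₁ × G₂`. -/

/-! ### Parametric integrals, winding numbers and Cauchy's theorem -/

/-- A parametric integral whose integrand is holomorphic in the parameter and locally bounded can
be differentiated under the integral sign. -/
theorem hasDerivAt_intervalIntegral_of_locally_bounded {V : Set ℂ} (hV : IsOpen V)
    {g : ℂ → ℝ → ℂ} {a b : ℝ} (hd : ∀ s, DifferentiableOn ℂ (fun z => g z s) V)
    (hc : ∀ z ∈ V, Continuous (g z))
    (hb : ∀ z ∈ V, ∃ R > 0, ∃ M : ℝ, ∀ ζ ∈ Metric.ball z R, ∀ s ∈ uIcc a b, ‖g ζ s‖ ≤ M)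
    {z : ℂ} (hz : z ∈ V) :
    HasDerivAt (fun z => ∫ s in a..b, g z s) (∫ s in a..b, deriv (fun z => g z s) z) z := by
  obtain ⟨R₁, hR₁, M, hM⟩ := hb z hz
  obtain ⟨R₂, hR₂, hV₂⟩ := Metric.isOpen_iff.1 hV z hz
  -- Circles of radius `r` about points of `ball z r` stay within `2 * r` of `z`, where `g` is
  -- bounded by `M`. Cauchy's estimate then bounds the derivative by `M / r`.
  obtain ⟨r, hr, hr₁, hr₂⟩ : ∃ r > 0, 2 * r < R₁ ∧ 2 * r < R₂ :=
    ⟨min R₁ R₂ / 4, by positivity, by linarith [min_le_left R₁ R₂, lt_min hR₁ hR₂],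
      by linarith [min_le_right R₁ R₂, lt_min hR₁ hR₂]⟩
  have hderiv : ∀ s, ∀ ζ ∈ V, HasDerivAt (fun z => g z s) (deriv (fun z => g z s) ζ) ζ :=
    fun s ζ hζ => ((hd s).differentiableAt (hV.mem_nhds hζ)).hasDerivAt
  have hsub : ∀ ζ ∈ Metric.ball z r, ∀ ζ' ∈ Metric.closedBall ζ r,
      ζ' ∈ V ∧ ζ' ∈ Metric.ball z R₁ := by
    intro ζ hζ ζ' hζ'
    have h : dist ζ' z < 2 * r := by
      have := dist_triangle ζ' ζ z
      rw [Metric.mem_ball] at hζ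
      rw [Metric.mem_closedBall] at hζ'
      linarith
    exact ⟨hV₂ (h.trans hr₂), h.trans hr₁⟩
  have hself : ∀ ζ ∈ Metric.ball z r, ζ ∈ V ∧ ζ ∈ Metric.ball z R₁ := fun ζ hζ =>
    hsub ζ hζ ζ (Metric.mem_closedBall_self hr.le)
  refine (intervalIntegral.hasDerivAt_integral_of_dominated_loc_of_deriv_le
    (bound := fun _ => M / r) (F' := fun ζ s => deriv (fun z => g z s) ζ)
    (Metric.ball_mem_nhds z hr) ?_ ((hc z hz).intervalIntegrable _ _) ?_ ?_
    intervalIntegrable_const ?_).2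
  · filter_upwards [Metric.ball_mem_nhds z hr] with ζ hζ
    exact (hc ζ (hself ζ hζ).1).aestronglyMeasurable
  -- The derivative is measurable in `s` as a limit of difference quotients; the steps `r / (n + 2)`
  -- are strictly smaller than `r` already for `n = 0`.
  · have hu : ∀ n : ℕ, z + (r / (n + 2) : ℝ) ∈ Metric.ball z r := by
      intro n
      rw [Metric.mem_ball, dist_eq_norm, add_sub_cancel_left, Complex.norm_real, Real.norm_eq_abs,
        abs_of_pos (by positivity)]
      exact div_lt_self hr (by linarith [n.cast_nonneg (α := ℝ)])
    have hlim : Tendsto (fun n : ℕ => z + ((r / (n + 2) : ℝ) : ℂ)) atTop (𝓝[≠] z) := by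
      refine tendsto_nhdsWithin_iff.2 ⟨?_, Eventually.of_forall fun n => ?_⟩
      · have h1 : Tendsto (fun n : ℕ => r / ((n : ℝ) + 2)) atTop (𝓝 0) :=
          tendsto_const_nhds.div_atTop
            (tendsto_atTop_add_const_right _ _ tendsto_natCast_atTop_atTop)
        have h2 := (Complex.continuous_ofReal.tendsto 0).comp h1
        simpa using tendsto_const_nhds (x := z) |>.add h2
      · have : r / ((n : ℝ) + 2) ≠ 0 := by positivity
        rw [mem_compl_singleton_iff, Ne, add_eq_left]
        exact Complex.ofReal_ne_zero.2 this
    refine aestronglyMeasurable_of_tendsto_ae (u := atTop)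
      (f := fun (n : ℕ) s => slope (fun z => g z s) z (z + ((r / (n + 2) : ℝ) : ℂ))) (fun n => ?_)
      (Eventually.of_forall fun s => (hderiv s z hz).tendsto_slope.comp hlim)
    simp only [slope_def_module]
    exact (((hc _ (hself _ (hu n)).1).sub (hc z hz)).const_smul
      (z + ((r / (n + 2) : ℝ) : ℂ) - z)⁻¹).aestronglyMeasurable
  · refine Eventually.of_forall fun s hs ζ hζ => ?_
    refine Complex.norm_deriv_le_of_forall_mem_sphere_norm_le hr ?_ fun ζ' hζ' =>
      hM ζ' (hsub ζ hζ ζ' (Metric.sphere_subset_closedBall hζ')).2 s (uIoc_subset_uIcc hs)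
    refine DifferentiableOn.diffContOnCl fun ζ' hζ' => ?_
    rw [closure_ball ζ hr.ne'] at hζ'
    exact (hd s).differentiableAt (hV.mem_nhds (hsub ζ hζ ζ' hζ').1) |>.differentiableWithinAt
  · exact Eventually.of_forall fun s _ ζ hζ => hderiv s ζ (hself ζ hζ).1

/-- The Cauchy transform `∫ u(s) / (γ(s) - z) ds` along a curve is holomorphic off the curve. -/
theorem hasDerivAt_cauchyTransform {γ u : ℝ → ℂ} (hγ : Continuous γ) (hu : Continuous u)
    (hcl : IsClosed (range γ)) {z : ℂ} (hz : z ∉ range γ) :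
    HasDerivAt (fun z => ∫ s in (0 : ℝ)..1, u s / (γ s - z))
      (∫ s in (0 : ℝ)..1, u s / (γ s - z) ^ 2) z := by
  have hne : ∀ ζ ∈ (range γ)ᶜ, ∀ s, γ s - ζ ≠ 0 := fun ζ hζ s h =>
    hζ ⟨s, sub_eq_zero.1 h⟩
  have hder : ∀ s, ∀ ζ ∈ (range γ)ᶜ,
      HasDerivAt (fun z => u s / (γ s - z)) (u s / (γ s - ζ) ^ 2) ζ := by
    intro s ζ hζ
    have h := ((hasDerivAt_id ζ).const_sub (γ s)).inv (hne ζ hζ s)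
    simpa [div_eq_mul_inv] using h.const_mul (u s)
  obtain ⟨M, hM⟩ := isCompact_uIcc.exists_bound_of_continuousOn
    (s := uIcc (0 : ℝ) 1) hu.continuousOn
  have key := hasDerivAt_intervalIntegral_of_locally_bounded (a := 0) (b := 1)
    hcl.isOpen_compl (g := fun z s => u s / (γ s - z))
    (fun s ζ hζ => (hder s ζ hζ).differentiableAt.differentiableWithinAt)
    (fun ζ hζ => hu.div (hγ.sub continuous_const) (hne ζ hζ)) ?_ hz
  · convert key using 1
    exact intervalIntegral.integral_congr fun s _ => (hder s z hz).deriv.symm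
  · intro ζ hζ
    obtain ⟨R, hR, hsub⟩ := Metric.isOpen_iff.1 hcl.isOpen_compl ζ hζ
    refine ⟨R / 2, by positivity, M / (R / 2), fun ζ' hζ' s hs => ?_⟩
    have h1 : R ≤ dist (γ s) ζ := by
      by_contra! h
      exact hsub h ⟨s, rfl⟩
    have h2 : R / 2 ≤ ‖γ s - ζ'‖ := by
      rw [← dist_eq_norm]
      have := dist_triangle (γ s) ζ' ζ
      rw [Metric.mem_ball] at hζ'
      linarith
    rw [norm_div]
    have := hM s hs
    gcongr
    exact (norm_nonneg _).trans this

/-- The Cauchy transform of a curve vanishes at infinity. -/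
theorem tendsto_cauchyTransform_cocompact {γ u : ℝ → ℂ} (hγ : Continuous γ) (hu : Continuous u) :
    Tendsto (fun z => ∫ s in (0 : ℝ)..1, u s / (γ s - z)) (cocompact ℂ) (𝓝 0) := by
  obtain ⟨M, hM⟩ := isCompact_uIcc.exists_bound_of_continuousOn
    (s := uIcc (0 : ℝ) 1) hu.continuousOn
  obtain ⟨R, hR⟩ := isCompact_uIcc.exists_bound_of_continuousOn
    (s := uIcc (0 : ℝ) 1) hγ.continuousOn
  have hlim : Tendsto (fun z : ℂ => M / (‖z‖ - R)) (cocompact ℂ) (𝓝 0) :=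
    tendsto_const_nhds.div_atTop
      (tendsto_atTop_add_const_right _ (-R) (tendsto_norm_cocompact_atTop (E := ℂ)))
  refine squeeze_zero_norm' ?_ hlim
  filter_upwards [(tendsto_norm_cocompact_atTop (E := ℂ)).eventually_gt_atTop R] with z hz
  have := intervalIntegral.norm_integral_le_of_norm_le_const (a := (0 : ℝ)) (b := 1)
    (f := fun s => u s / (γ s - z)) (C := M / (‖z‖ - R)) fun s hs => by
      have h1 := hM s (uIoc_subset_uIcc hs)
      have h2 := hR s (uIoc_subset_uIcc hs)
      have h3 : ‖z‖ - R ≤ ‖γ s - z‖ := by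
        have := norm_sub_norm_le z (γ s)
        rw [norm_sub_rev] at this
        linarith
      rw [norm_div]
      gcongr
      exact (norm_nonneg _).trans h1
  simpa using this

/-- A closed curve has winding number zero about the points of the unbounded components of its
complement. -/
theorem winding_eq_zero_of_not_isBounded {γ : ℝ → ℂ} (hγ : ContDiff ℝ 1 γ)
    (hper : Function.Periodic γ 1) (hcl : IsClosed (range γ)) {z : ℂ} (hz : z ∉ range γ)
    (hub : ¬ Bornology.IsBounded (connectedComponentIn (range γ)ᶜ z)) :
    ∫ s in (0 : ℝ)..1, deriv γ s / (γ s - z) = 0 := by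
  have hγ' : Continuous (deriv γ) := hγ.continuous_deriv le_rfl
  set N : ℂ → ℂ := fun z => ∫ s in (0 : ℝ)..1, deriv γ s / (γ s - z) with hN
  set V := connectedComponentIn (range γ)ᶜ z
  have hVsub : V ⊆ (range γ)ᶜ := connectedComponentIn_subset _ _
  -- The derivative of `N` integrates `γ' / (γ - ζ)²`, which has the periodic primitive `-(γ -
  -- ζ)⁻¹`. So `N` is constant on the unbounded component `V`, and its limit at infinity is `0`.
  have hder : ∀ ζ ∈ V, HasDerivAt N 0 ζ := by
    intro ζ hζ
    have hne : ∀ s, γ s - ζ ≠ 0 := fun s h => hVsub hζ ⟨s, sub_eq_zero.1 h⟩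
    have h := hasDerivAt_cauchyTransform hγ.continuous hγ' hcl (hVsub hζ)
    have h0 : ∫ s in (0 : ℝ)..1, deriv γ s / (γ s - ζ) ^ 2 = 0 := by
      rw [intervalIntegral.integral_eq_sub_of_hasDerivAt (f := fun s => -(γ s - ζ)⁻¹)]
      · have := hper 0
        rw [zero_add] at this
        simp [this]
      · intro s _
        have h1 := (((hγ.differentiable one_ne_zero) s).hasDerivAt.sub_const ζ).inv (hne s)
        have h2 : HasDerivAt (fun s => -(γ s - ζ)⁻¹) (-(-deriv γ s / (γ s - ζ) ^ 2)) s := h1.neg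
        rwa [neg_div, neg_neg] at h2
      · exact (hγ'.div ((hγ.continuous.sub continuous_const).pow 2)
          fun s => pow_ne_zero 2 (hne s)).intervalIntegrable _ _
    rwa [h0] at h
  have hconst : ∀ ζ ∈ V, N ζ = N z := fun ζ hζ =>
    hcl.isOpen_compl.connectedComponentIn.is_const_of_deriv_eq_zero
      isPreconnected_connectedComponentIn
      (fun ξ hξ => (hder ξ hξ).differentiableAt.differentiableWithinAt)
      (fun ξ hξ => (hder ξ hξ).deriv) hζ (mem_connectedComponentIn hz)
  have hfreq : ∃ᶠ ζ in cocompact ℂ, ζ ∈ V := by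
    rw [← Metric.cobounded_eq_cocompact]
    intro h
    exact hub (Bornology.isBounded_def.2 h)
  have hlim := tendsto_cauchyTransform_cocompact hγ.continuous hγ'
  by_contra hne
  have hev := hlim.eventually_ne (Ne.symm hne)
  obtain ⟨ζ, hζ, hζ'⟩ := (hfreq.and_eventually hev).exists
  exact hζ' (hconst ζ hζ)

/-- **Cauchy's theorem** for a closed curve and a function that is analytic on the curve and on the
bounded components of its complement (Dixon's proof). -/
theorem integral_eq_zero_of_analyticAt {γ : ℝ → ℂ} (hγ : ContDiff ℝ 1 γ)
    (hper : Function.Periodic γ 1) (hcl : IsClosed (range γ)) {f : ℂ → ℂ}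
    (hf : ∀ z, Bornology.IsBounded (connectedComponentIn (range γ)ᶜ z) → AnalyticAt ℂ f z) :
    ∫ s in (0 : ℝ)..1, f (γ s) * deriv γ s = 0 := by
  classical
  have hγ' : Continuous (deriv γ) := hγ.continuous_deriv le_rfl
  -- `K` contains the curve itself: for a point outside the given set, `connectedComponentIn` is
  -- empty, hence bounded.
  set K : Set ℂ := {z | Bornology.IsBounded (connectedComponentIn (range γ)ᶜ z)} with hK
  have hγK : ∀ s, γ s ∈ K := fun s => by
    have : γ s ∉ (range γ)ᶜ := fun h => h ⟨s, rfl⟩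
    simp [hK, connectedComponentIn_eq_empty this]
  have hKc : ∀ z ∈ Kᶜ, z ∉ range γ := by
    rintro z hz ⟨s, rfl⟩
    exact hz (hγK s)
  have hKo : IsOpen Kᶜ := by
    refine isOpen_iff_mem_nhds.2 fun z hz => ?_
    refine mem_of_superset (hcl.isOpen_compl.connectedComponentIn.mem_nhds
      (mem_connectedComponentIn (hKc z hz))) fun ζ hζ => ?_
    rw [mem_compl_iff, hK, mem_ofPred_eq, ← connectedComponentIn_eq hζ]
    exact hz
  -- The factor `z - t` makes `F` vanish at the point `t` of the curve, so the slope of `F` at `t`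
  -- is `f` and the integral `h₁ t` below is the one to be shown zero.
  set t := γ 0 with ht
  set F : ℂ → ℂ := fun z => (z - t) * f z with hF
  set U : Set ℂ := {z | AnalyticAt ℂ F z} with hU
  have hUo : IsOpen U := isOpen_analyticAt ℂ F
  have hKU : K ⊆ U := fun z hz => (analyticAt_id.sub analyticAt_const).mul (hf z hz)
  have hFd : DifferentiableOn ℂ F U := fun z hz =>
    AnalyticAt.differentiableAt hz |>.differentiableWithinAt
  have hFγ : Continuous fun s => F (γ s) := continuous_iff_continuousAt.2 fun s =>
    ContinuousAt.comp (AnalyticAt.continuousAt (hKU (hγK s))) hγ.continuous.continuousAt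
  have hds : ∀ z ∈ U, DifferentiableOn ℂ (dslope F z) U := fun z hz =>
    (Complex.differentiableOn_dslope (hUo.mem_nhds hz)).2 hFd
  have hdsγ : ∀ z ∈ U, Continuous fun s => dslope F z (γ s) := fun z hz =>
    continuous_iff_continuousAt.2 fun s => ContinuousAt.comp
      (((hds z hz).differentiableAt (hUo.mem_nhds (hKU (hγK s)))).continuousAt)
      hγ.continuous.continuousAt
  have hsymm : ∀ z w, dslope F z w = dslope F w z := by
    intro z w
    rcases eq_or_ne w z with rfl | h
    · rfl
    · rw [dslope_of_ne _ h, dslope_of_ne _ h.symm, slope_comm]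
  set h₁ : ℂ → ℂ := fun z => ∫ s in (0 : ℝ)..1, dslope F z (γ s) * deriv γ s with hh₁
  set h₂ : ℂ → ℂ := fun z => ∫ s in (0 : ℝ)..1, F (γ s) * deriv γ s / (γ s - z) with hh₂
  -- The two integrals differ by `F z` times the winding number about `z`, which is zero off `K`.
  have hagree : ∀ z ∈ U ∩ Kᶜ, h₁ z = h₂ z := by
    intro z hz
    have hzγ := hKc z hz.2
    have hne : ∀ s, γ s - z ≠ 0 := fun s h => hzγ ⟨s, sub_eq_zero.1 h⟩
    have hw := winding_eq_zero_of_not_isBounded hγ hper hcl hzγ hz.2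
    have hcz := hγ.continuous.sub (continuous_const (y := z))
    have : h₁ z = h₂ z - F z * ∫ s in (0 : ℝ)..1, deriv γ s / (γ s - z) := by
      have hi₁ : Continuous fun s => F (γ s) * deriv γ s / (γ s - z) :=
        (hFγ.mul hγ').div hcz hne
      have hi₂ : Continuous fun s => F z * (deriv γ s / (γ s - z)) :=
        continuous_const.mul (hγ'.div hcz hne)
      simp only [hh₁, hh₂]
      rw [← intervalIntegral.integral_const_mul, ← intervalIntegral.integral_sub
        (hi₁.intervalIntegrable _ _) (hi₂.intervalIntegrable _ _)]
      refine intervalIntegral.integral_congr fun s _ => ?_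
      rw [dslope_of_ne _ (sub_ne_zero.1 (hne s)), slope_def_field]
      field_simp
    rw [this, hw, mul_zero, sub_zero]
  have hd₁ : ∀ z ∈ U, DifferentiableAt ℂ h₁ z := by
    intro z hz
    refine (hasDerivAt_intervalIntegral_of_locally_bounded hUo (a := 0) (b := 1)
      (g := fun z s => dslope F z (γ s) * deriv γ s) (fun s => ?_)
      (fun ζ hζ => (hdsγ ζ hζ).mul hγ') (fun ζ hζ => ?_) hz).differentiableAt
    -- By symmetry of the slope, holomorphy in the base point is holomorphy in the other argument.
    · simp_rw [fun ζ => hsymm ζ (γ s)]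
      exact (hds _ (hKU (hγK s))).mul_const _
    · obtain ⟨R, hR, hRU⟩ := Metric.nhds_basis_closedBall.mem_iff.1 (hUo.mem_nhds hζ)
      have hcF' : ContinuousOn (deriv F) (Metric.closedBall ζ R) := fun ξ hξ =>
        (AnalyticAt.deriv (hRU hξ)).continuousAt.continuousWithinAt
      obtain ⟨C₁, hC₁⟩ := (isCompact_closedBall ζ R).exists_bound_of_continuousOn hcF'
      obtain ⟨C₂, hC₂⟩ := (isCompact_closedBall ζ R).exists_bound_of_continuousOn
        (hFd.continuousOn.mono hRU)
      obtain ⟨C₃, hC₃⟩ := isCompact_uIcc.exists_bound_of_continuousOn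
        (s := uIcc (0 : ℝ) 1) hFγ.continuousOn
      obtain ⟨C₄, hC₄⟩ := isCompact_uIcc.exists_bound_of_continuousOn
        (s := uIcc (0 : ℝ) 1) hγ'.continuousOn
      -- If `γ s` lies in the closed `R`-ball, the mean value inequality bounds the slope by `C₁`;
      -- otherwise its denominator is at least `R / 2`.
      refine ⟨R / 2, by positivity, max C₁ ((C₃ + C₂) / (R / 2)) * C₄, fun ξ hξ s hs => ?_⟩
      have hξ' : ξ ∈ Metric.closedBall ζ R :=
        Metric.ball_subset_closedBall (Metric.ball_subset_ball (by linarith) hξ)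
      rw [norm_mul]
      have h4 := hC₄ s hs
      have h0 : 0 ≤ C₁ := (norm_nonneg _).trans (hC₁ ξ hξ')
      refine mul_le_mul ?_ h4 (norm_nonneg _) (le_max_of_le_left h0)
      by_cases hs' : γ s ∈ Metric.closedBall ζ R
      · refine le_max_of_le_left ?_
        rcases eq_or_ne (γ s) ξ with h | h
        · rw [h, dslope_same]
          exact hC₁ ξ hξ'
        · have hmv := (convex_closedBall ζ R).norm_image_sub_le_of_norm_deriv_le
            (f := F) (C := C₁) (fun w hw => AnalyticAt.differentiableAt (hRU hw)) hC₁ hξ' hs'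
          rw [dslope_of_ne _ h, slope_def_field, norm_div]
          exact div_le_of_le_mul₀ (norm_nonneg _) h0 hmv
      · refine le_max_of_le_right ?_
        have hfar : R / 2 ≤ ‖γ s - ξ‖ := by
          rw [← dist_eq_norm]
          have := dist_triangle (γ s) ξ ζ
          rw [Metric.mem_ball] at hξ
          rw [Metric.mem_closedBall, not_le] at hs'
          linarith
        have h : γ s ≠ ξ := by
          rintro h
          rw [h, sub_self, norm_zero] at hfar
          linarith
        rw [dslope_of_ne _ h, slope_def_field, norm_div]
        have := (norm_sub_le (F (γ s)) (F ξ)).trans (add_le_add (hC₃ s hs) (hC₂ ξ hξ'))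
        gcongr
        exact (norm_nonneg _).trans this
  -- The glued function is entire and tends to `0` at infinity, so it vanishes by Liouville's
  -- theorem.
  set h : ℂ → ℂ := fun z => if z ∈ K then h₁ z else h₂ z with hh
  have hhU : ∀ z ∈ U, h z = h₁ z := by
    intro z hz
    by_cases hzK : z ∈ K
    · simp only [hh, if_pos hzK]
    · simp only [hh, if_neg hzK]
      exact (hagree z ⟨hz, hzK⟩).symm
  have hhK : ∀ z ∈ Kᶜ, h z = h₂ z := fun z hz => by
    simp only [hh]
    exact if_neg hz
  have hhd : Differentiable ℂ h := by
    intro z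
    by_cases hzK : z ∈ K
    · exact (hd₁ z (hKU hzK)).congr_of_eventuallyEq
        (eventually_of_mem (hUo.mem_nhds (hKU hzK)) hhU)
    · exact (hasDerivAt_cauchyTransform hγ.continuous (hFγ.mul hγ') hcl
        (hKc z hzK)).differentiableAt.congr_of_eventuallyEq
        (eventually_of_mem (hKo.mem_nhds hzK) hhK)
  have hbig : ∀ᶠ z in cocompact ℂ, z ∈ Kᶜ := by
    have hcpt : IsCompact (range γ) := by
      rw [← hper.image_Icc one_pos 0]
      exact isCompact_Icc.image hγ.continuous
    obtain ⟨R, hR⟩ := hcpt.isBounded.exists_norm_le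
    filter_upwards [(tendsto_norm_cocompact_atTop (E := ℂ)).eventually_gt_atTop (max R 0)]
      with z hz hzK
    obtain ⟨hz1, hz2⟩ := max_lt_iff.1 hz
    -- Beyond a disc containing the curve, the ray from `z` away from the origin never meets it, so
    -- the component of `z` is unbounded.
    have hray : (fun r : ℝ => (r : ℂ) * z) '' Ici 1 ⊆ connectedComponentIn (range γ)ᶜ z := by
      refine IsPreconnected.subset_connectedComponentIn
        (isPreconnected_Ici.image _ (by fun_prop)) ⟨1, self_mem_Ici, by simp⟩ ?_
      rintro _ ⟨r, hr, rfl⟩ hmem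
      have h1 := hR _ hmem
      rw [mem_Ici] at hr
      rw [norm_mul, Complex.norm_real, Real.norm_of_nonneg (by linarith)] at h1
      nlinarith
    have hzK' : Bornology.IsBounded (connectedComponentIn (range γ)ᶜ z) := hzK
    obtain ⟨M, hM⟩ := (hzK'.subset hray).exists_norm_le
    have h1 := hM _ ⟨max 1 ((|M| + 1) / ‖z‖), mem_Ici.2 (le_max_left _ _), rfl⟩
    rw [norm_mul, Complex.norm_real, Real.norm_of_nonneg (by positivity)] at h1
    have h2 : (|M| + 1) / ‖z‖ * ‖z‖ ≤ M :=
      (mul_le_mul_of_nonneg_right (le_max_right _ _) hz2.le).trans h1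
    rw [div_mul_cancel₀ _ hz2.ne'] at h2
    linarith [le_abs_self M]
  have hlim : Tendsto h (cocompact ℂ) (𝓝 0) :=
    (tendsto_cauchyTransform_cocompact hγ.continuous (hFγ.mul hγ')).congr'
      (hbig.mono fun z hz => (hhK z hz).symm)
  have h0 : h₁ t = 0 := by
    rw [← hhU t (hKU (hγK 0))]
    exact hhd.apply_eq_of_tendsto_cocompact t hlim
  rw [← h0]
  refine intervalIntegral.integral_congr fun s _ => ?_
  congr 1
  have hFt : F t = 0 := by simp [hF]
  rcases eq_or_ne (γ s) t with hs | hs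
  · rw [hs, dslope_same]
    have := ((hasDerivAt_id t).sub_const t).mul (hf t (hγK 0)).differentiableAt.hasDerivAt
    simp only [id, sub_self, zero_mul, add_zero, one_mul] at this
    exact this.deriv.symm
  · rw [dslope_of_ne _ hs, slope_def_field, hFt, sub_zero, hF,
      mul_div_cancel_left₀ _ (sub_ne_zero.2 hs)]

/-! ### Local geometry of a regular curve -/

/-- Mean value inequality for `u s - s`. It is applied to `u = w / w'(0)`, whose tangent at the
origin is the real axis. -/
theorem norm_sub_le_of_norm_deriv_sub_one_le {u : ℝ → ℂ} (hu : ContDiff ℝ 1 u) (h0 : u 0 = 0)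
    {η : ℝ} (hη : ∀ s, |s| ≤ η → ‖deriv u s - 1‖ ≤ 1 / 4) {s : ℝ} (hs : |s| ≤ η) :
    ‖u s - s‖ ≤ |s| / 4 := by
  have hd : ∀ r ∈ Icc (-η) η, HasDerivWithinAt (fun r : ℝ => u r - (r : ℂ)) (deriv u r - 1)
      (Icc (-η) η) r := fun r _ =>
    (((hu.differentiable one_ne_zero) r).hasDerivAt.sub
      (Complex.ofRealCLM.hasDerivAt (x := r))).hasDerivWithinAt
  have h := (convex_Icc (-η) η).norm_image_sub_le_of_norm_hasDerivWithin_le hd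
    (fun r hr => hη r (abs_le.2 hr)) (x := 0) (y := s)
    (abs_le.1 (by simpa using (abs_nonneg s).trans hs)) (abs_le.1 hs)
  simp only [h0, Complex.ofReal_zero, sub_zero, Real.norm_eq_abs] at h
  linarith

/-- The derivative of `‖u‖²` is `2⟨u, u'⟩`. Expanding about `u = s`, `u' = 1` leaves three error
terms of size at most `s/4`, `s/4` and `s/16`, so the inner product stays positive for `s > 0`. -/
theorem strictMonoOn_norm_of_norm_deriv_sub_one_le {u : ℝ → ℂ} (hu : ContDiff ℝ 1 u)
    (h0 : u 0 = 0) {η : ℝ} (hη : ∀ s, |s| ≤ η → ‖deriv u s - 1‖ ≤ 1 / 4) :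
    StrictMonoOn (fun s => ‖u s‖) (Icc 0 η) := by
  have hsq : StrictMonoOn (fun s => ‖u s‖ ^ 2) (Icc 0 η) := by
    refine strictMonoOn_of_deriv_pos (convex_Icc _ _)
      (hu.continuous.norm.pow 2).continuousOn fun s hs => ?_
    rw [interior_Icc] at hs
    have hs' : |s| ≤ η := by rw [abs_of_pos hs.1]; exact hs.2.le
    rw [((hu.differentiable one_ne_zero) s).hasDerivAt.norm_sq.deriv]
    have h1 := norm_sub_le_of_norm_deriv_sub_one_le hu h0 hη hs'
    have h2 := hη s hs'
    rw [abs_of_pos hs.1] at h1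
    have h3 : inner ℝ (u s) (deriv u s) = s + s * (deriv u s - 1).re + (u s - s).re
        + inner ℝ (u s - s) (deriv u s - 1) := by
      simp [Complex.inner]
      ring
    have h4 := (abs_le.1 ((Complex.abs_re_le_norm _).trans h2)).1
    have h5 := (abs_le.1 ((Complex.abs_re_le_norm _).trans h1)).1
    have h6 := (abs_le.1 ((abs_real_inner_le_norm (u s - s) (deriv u s - 1)).trans
      (mul_le_mul h1 h2 (norm_nonneg _) (by linarith [hs.1])))).1
    rw [h3]
    nlinarith [hs.1]
  intro a ha b hb hab
  exact lt_of_pow_lt_pow_left₀ 2 (norm_nonneg _) (hsq ha hb hab)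

/-- Near a point where its derivative does not vanish, a curve stays in a cone about its tangent. -/
theorem exists_forall_norm_deriv_div_sub_one_le {w : ℝ → ℂ} (hw : ContDiff ℝ 1 w)
    (hT : deriv w 0 ≠ 0) {δ : ℝ} (hδ : 0 < δ) :
    ∃ η > 0, η < δ ∧ ∀ s, |s| ≤ η → ‖deriv w s / deriv w 0 - 1‖ ≤ 1 / 4 := by
  have hc : Continuous fun s => deriv w s / deriv w 0 - 1 :=
    ((hw.continuous_deriv le_rfl).div_const _).sub continuous_const
  have h := hc.norm.tendsto 0
  simp only [div_self hT, sub_self, norm_zero] at h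
  obtain ⟨η, hη, hsub⟩ := Metric.eventually_nhds_iff.1 (h.eventually_lt_const
    (show (0 : ℝ) < 1 / 4 by norm_num))
  refine ⟨min η δ / 2, by positivity, by linarith [min_le_right η δ, lt_min hη hδ], fun s hs => ?_⟩
  refine (hsub ?_).le
  rw [Real.dist_eq, sub_zero]
  linarith [min_le_left η δ, lt_min hη hδ]

/-- The part of a simple closed curve at distance at least `ε` from one of its points is an arc. -/
theorem exists_cut_params {w : ℝ → ℂ} (hw : ContDiff ℝ 1 w) (h0 : w 0 = 0) {η : ℝ}
    (hη0 : 0 < η) (hη1 : η < 1 / 2) (hT : deriv w 0 ≠ 0)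
    (hη : ∀ s, |s| ≤ η → ‖deriv w s / deriv w 0 - 1‖ ≤ 1 / 4)
    (hne : ∀ s, |s| ≤ 1 / 2 → s ≠ 0 → w s ≠ 0) :
    ∃ sm sp : ℝ → ℝ, Tendsto sm (𝓝[>] 0) (𝓝[<] 0) ∧ Tendsto sp (𝓝[>] 0) (𝓝[>] 0) ∧
      ∀ᶠ ε in 𝓝[>] 0, sm ε ∈ Ioo (-η) 0 ∧ sp ε ∈ Ioo 0 η ∧ ‖w (sm ε)‖ = ε ∧ ‖w (sp ε)‖ = ε ∧
        ∀ s, |s| ≤ 1 / 2 → (ε ≤ ‖w s‖ ↔ s ≤ sm ε ∨ sp ε ≤ s) := by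
  set T := deriv w 0 with hTdef
  have hT0 : 0 < ‖T‖ := norm_pos_iff.2 hT
  have hwd : ∀ s, HasDerivAt w (deriv w s) s := fun s =>
    ((hw.differentiable one_ne_zero) s).hasDerivAt
  have hu : ContDiff ℝ 1 fun s => w s / T := hw.div_const T
  have hud : ∀ s, deriv (fun s => w s / T) s = deriv w s / T := fun s =>
    ((hwd s).div_const T).deriv
  -- The reversed curve, again with tangent `1`, handles negative parameters.
  have hv : ContDiff ℝ 1 fun s => -(w (-s) / T) := (hu.comp contDiff_neg).neg
  have hvd : ∀ s, deriv (fun s => -(w (-s) / T)) s = deriv w (-s) / T := fun s => by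
    have h := (((hwd (-s)).scomp s (hasDerivAt_neg s)).div_const T).neg
    have h2 : HasDerivAt (fun s => -(w (-s) / T)) _ s := h
    rw [h2.deriv]
    simp [neg_div]
  have hcone : ∀ s, |s| ≤ η → ‖w s / T - s‖ ≤ |s| / 4 := fun s hs =>
    norm_sub_le_of_norm_deriv_sub_one_le hu (by simp [h0]) (fun r hr => by
      rw [hud]; exact hη r hr) hs
  have hmono₁ : StrictMonoOn (fun s => ‖w s‖) (Icc 0 η) := by
    have h := strictMonoOn_norm_of_norm_deriv_sub_one_le hu (by simp [h0])
      (η := η) (fun r hr => by rw [hud]; exact hη r hr)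
    intro a ha b hb hab
    have := h ha hb hab
    simp only [norm_div] at this
    exact (div_lt_div_iff_of_pos_right hT0).1 this
  have hmono₂ : StrictMonoOn (fun s => ‖w (-s)‖) (Icc 0 η) := by
    have h := strictMonoOn_norm_of_norm_deriv_sub_one_le hv (by simp [h0])
      (η := η) (fun r hr => by rw [hvd]; exact hη (-r) (by rwa [abs_neg]))
    intro a ha b hb hab
    have := h ha hb hab
    simp only [norm_div, norm_neg] at this
    exact (div_lt_div_iff_of_pos_right hT0).1 this
  have hlow : ∀ s, |s| ≤ η → 3 / 4 * |s| * ‖T‖ ≤ ‖w s‖ := by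
    intro s hs
    have h1 := hcone s hs
    have h2 := norm_sub_norm_le (s : ℂ) ((s : ℂ) - w s / T)
    rw [sub_sub_cancel, norm_sub_rev, Complex.norm_real, Real.norm_eq_abs, norm_div] at h2
    have h3 : 3 / 4 * |s| ≤ ‖w s‖ / ‖T‖ := by linarith
    exact (le_div_iff₀ hT0).1 h3
  -- The part of the curve with `η ≤ |s| ≤ 1/2` keeps a distance `m` from the origin, so for `ε < m`
  -- the cut happens inside `|s| < η`, where the distance is monotone on each side.
  obtain ⟨m, hm0, hm⟩ : ∃ m > 0, ∀ s, η ≤ |s| → |s| ≤ 1 / 2 → m ≤ ‖w s‖ := by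
    have hK : IsCompact (Icc (-(1 / 2) : ℝ) (1 / 2) ∩ {s | η ≤ |s|}) :=
      isCompact_Icc.inter_right (isClosed_le continuous_const continuous_abs)
    obtain ⟨s₀, hs₀, hmin⟩ := hK.exists_isMinOn
      ⟨1 / 2, ⟨by norm_num, le_rfl⟩, by
        rw [mem_ofPred_eq, abs_of_pos (by norm_num)]; exact hη1.le⟩ hw.continuous.norm.continuousOn
    refine ⟨‖w s₀‖, norm_pos_iff.2 (hne s₀ (abs_le.2 hs₀.1) ?_),
      fun s h1 h2 => hmin ⟨abs_le.1 h2, h1⟩⟩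
    rintro rfl
    have : η ≤ |(0 : ℝ)| := hs₀.2
    rw [abs_zero] at this
    linarith
  have hηm : m ≤ ‖w η‖ := hm η (le_abs_self η) (by rw [abs_of_pos hη0]; exact hη1.le)
  have hηm' : m ≤ ‖w (-η)‖ := hm (-η) (by rw [abs_neg]; exact le_abs_self η)
    (by rw [abs_neg, abs_of_pos hη0]; exact hη1.le)
  have hex : ∀ ε, ∃ a b : ℝ, 0 < ε → ε < m → a ∈ Ioo 0 η ∧ b ∈ Ioo 0 η ∧ ‖w (-a)‖ = ε ∧
      ‖w b‖ = ε := by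
    intro ε
    by_cases h : 0 < ε ∧ ε < m
    · obtain ⟨b, hb, hb'⟩ := intermediate_value_Ioo hη0.le hw.continuous.norm.continuousOn
        (show ε ∈ Ioo ‖w 0‖ ‖w η‖ from ⟨by simpa [h0] using h.1, h.2.trans_le hηm⟩)
      obtain ⟨a, ha, ha'⟩ := intermediate_value_Ioo hη0.le
        (hw.continuous.comp continuous_neg).norm.continuousOn
        (show ε ∈ Ioo ‖(w ∘ Neg.neg) 0‖ ‖(w ∘ Neg.neg) η‖ from
          ⟨by simpa [h0] using h.1, h.2.trans_le hηm'⟩)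
      exact ⟨a, b, fun _ _ => ⟨ha, hb, ha', hb'⟩⟩
    · exact ⟨0, 0, fun h1 h2 => absurd ⟨h1, h2⟩ h⟩
  choose a b hab using hex
  have hev : ∀ᶠ ε in 𝓝[>] (0 : ℝ), 0 < ε ∧ ε < m := by
    filter_upwards [self_mem_nhdsWithin, nhdsWithin_le_nhds (Iio_mem_nhds hm0)] with ε h1 h2
    exact ⟨h1, h2⟩
  have hlim : Tendsto (fun ε : ℝ => ε / (3 / 4 * ‖T‖)) (𝓝[>] 0) (𝓝 0) := by
    have : Tendsto (fun ε : ℝ => ε / (3 / 4 * ‖T‖)) (𝓝 0) (𝓝 (0 / (3 / 4 * ‖T‖))) :=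
      tendsto_id.div_const _
    rw [zero_div] at this
    exact this.mono_left nhdsWithin_le_nhds
  have hbnd : ∀ s ε, |s| ≤ η → ‖w s‖ = ε → |s| ≤ ε / (3 / 4 * ‖T‖) := by
    intro s ε hs h
    rw [le_div_iff₀ (by positivity), ← h]
    linarith [hlow s hs]
  have hIoo : ∀ s ∈ Ioo 0 η, |s| ≤ η := fun s hs => by rw [abs_of_pos hs.1]; exact hs.2.le
  refine ⟨fun ε => -a ε, b, ?_, ?_, ?_⟩
  · refine tendsto_nhdsWithin_iff.2 ⟨squeeze_zero_norm' ?_ hlim, ?_⟩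
    · filter_upwards [hev] with ε hε
      obtain ⟨h1, -, h3, -⟩ := hab ε hε.1 hε.2
      exact hbnd _ _ (by rw [abs_neg]; exact hIoo _ h1) h3
    · filter_upwards [hev] with ε hε
      exact neg_lt_zero.2 (hab ε hε.1 hε.2).1.1
  · refine tendsto_nhdsWithin_iff.2 ⟨squeeze_zero_norm' ?_ hlim, ?_⟩
    · filter_upwards [hev] with ε hε
      obtain ⟨-, h2, -, h4⟩ := hab ε hε.1 hε.2
      exact hbnd _ _ (hIoo _ h2) h4
    · filter_upwards [hev] with ε hε
      exact (hab ε hε.1 hε.2).2.1.1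
  · filter_upwards [hev] with ε hε
    obtain ⟨h1, h2, h3, h4⟩ := hab ε hε.1 hε.2
    refine ⟨⟨neg_lt_neg h1.2, neg_lt_zero.2 h1.1⟩, h2, h3, h4, fun s hs => ?_⟩
    rcases le_or_gt η |s| with hsη | hsη
    · have h5 := hm s hsη hs
      refine ⟨fun _ => ?_, fun _ => by linarith [hε.2]⟩
      rcases le_abs.1 hsη with h | h
      · exact Or.inr (by linarith [h2.2])
      · exact Or.inl (by linarith [h1.2])
    · rcases le_or_gt 0 s with h | h
      · have h5 := hmono₁.le_iff_le ⟨h2.1.le, h2.2.le⟩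
          (show s ∈ Icc 0 η from ⟨h, (le_abs_self s).trans hsη.le⟩)
        simp only [h4] at h5
        rw [h5]
        exact ⟨Or.inr, fun h' => h'.resolve_left fun h'' => by linarith [h1.1]⟩
      · have h5 := hmono₂.le_iff_le ⟨h1.1.le, h1.2.le⟩
          (show -s ∈ Icc 0 η from ⟨by linarith, (neg_le_abs s).trans hsη.le⟩)
        simp only [h3, neg_neg] at h5
        rw [h5]
        exact ⟨fun h' => Or.inl (by linarith),
          fun h' => by linarith [h'.resolve_right fun h'' => by linarith [h2.1]]⟩

/-! ### The principal value of the Cauchy kernel -/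

theorem tendsto_integral_div_sub {w v : ℝ → ℂ} (hw : Continuous w) (hv : Continuous v) {a b : ℝ}
    (hne : ∀ s ∈ uIcc a b, w s ≠ 0) :
    Tendsto (fun z => ∫ s in a..b, v s / (w s - z)) (𝓝 0) (𝓝 (∫ s in a..b, v s / w s)) := by
  obtain ⟨M, hM⟩ := isCompact_uIcc.exists_bound_of_continuousOn (s := uIcc a b) hv.continuousOn
  obtain ⟨s₀, hs₀, hmin⟩ := (isCompact_uIcc (a := a) (b := b)).exists_isMinOn nonempty_uIcc
    hw.norm.continuousOn
  have hm : 0 < ‖w s₀‖ := norm_pos_iff.2 (hne s₀ hs₀)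
  have hball : ∀ᶠ z in 𝓝 (0 : ℂ), ∀ s ∈ uIcc a b, ‖w s₀‖ / 2 ≤ ‖w s - z‖ := by
    filter_upwards [Metric.ball_mem_nhds (0 : ℂ) (half_pos hm)] with z hz s hs
    rw [mem_ball_zero_iff] at hz
    have h1 : ‖w s₀‖ ≤ ‖w s‖ := hmin hs
    have h2 := norm_sub_norm_le (w s) z
    linarith
  refine intervalIntegral.tendsto_integral_filter_of_dominated_convergence
    (fun _ => M / (‖w s₀‖ / 2)) ?_ ?_ intervalIntegrable_const ?_
  · filter_upwards [hball] with z hz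
    have : ContinuousOn (fun s => v s / (w s - z)) (uIcc a b) :=
      hv.continuousOn.div (hw.sub continuous_const).continuousOn fun s hs h => by
        have := hz s hs
        rw [h, norm_zero] at this
        linarith
    exact (this.mono uIoc_subset_uIcc).aestronglyMeasurable measurableSet_uIoc
  · filter_upwards [hball] with z hz
    refine Eventually.of_forall fun s hs => ?_
    have h1 := hM s (uIoc_subset_uIcc hs)
    have h2 := hz s (uIoc_subset_uIcc hs)
    rw [norm_div]
    gcongr
    exact (norm_nonneg _).trans h1
  · refine Eventually.of_forall fun s hs => ?_
    have h : Tendsto (fun z => v s / (w s - z)) (𝓝 0) (𝓝 (v s / (w s - 0))) :=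
      tendsto_const_nhds.div (tendsto_const_nhds.sub tendsto_id)
        (by rw [sub_zero]; exact hne s (uIoc_subset_uIcc hs))
    rwa [sub_zero] at h

theorem Complex.log_neg_of_im_pos {z : ℂ} (hz : 0 < z.im) :
    Complex.log (-z) = Complex.log z - Real.pi * Complex.I := by
  rw [Complex.log, Complex.log, norm_neg, Complex.arg_neg_eq_arg_sub_pi_of_im_pos hz]
  push_cast
  ring

section LocalLog

variable {w : ℝ → ℂ} {η : ℝ}

/-- The cone condition in quantitative form: the real part of `w / w'(0)` has the sign of `s`. -/
theorem le_mul_re_div_deriv (hw : ContDiff ℝ 1 w) (h0 : w 0 = 0)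
    (hη : ∀ s, |s| ≤ η → ‖deriv w s / deriv w 0 - 1‖ ≤ 1 / 4) {s : ℝ} (hs : |s| ≤ η) :
    3 / 4 * s ^ 2 ≤ s * (w s / deriv w 0).re := by
  have hu : ContDiff ℝ 1 fun s => w s / deriv w 0 := hw.div_const _
  have hud : ∀ s, deriv (fun s => w s / deriv w 0) s = deriv w s / deriv w 0 := fun s =>
    (((hw.differentiable one_ne_zero) s).hasDerivAt.div_const _).deriv
  have h1 := norm_sub_le_of_norm_deriv_sub_one_le hu (by simp [h0])
    (fun r hr => by rw [hud]; exact hη r hr) hs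
  have h2 := (Complex.abs_re_le_norm _).trans h1
  rw [Complex.sub_re, Complex.ofReal_re] at h2
  have h3 := abs_le.1 (show |s * ((w s / deriv w 0).re - s)| ≤ s ^ 2 / 4 by
    rw [abs_mul, ← sq_abs s]
    nlinarith [abs_nonneg s])
  linarith [h3.1]

/-- At `s = 0` the point is `δ > 0`; elsewhere its imaginary part is `σ` times the nonzero real part
of `w / w'(0)`. So the principal logarithm is smooth along the local arc. -/
theorem add_I_mul_mem_slitPlane (hw : ContDiff ℝ 1 w) (h0 : w 0 = 0)
    (hη : ∀ s, |s| ≤ η → ‖deriv w s / deriv w 0 - 1‖ ≤ 1 / 4) {σ : ℝ} (hσ : σ * σ = 1)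
    {δ s : ℝ} (hs : |s| ≤ η) (hδ : 0 < δ ∨ s ≠ 0) :
    (δ : ℂ) + Complex.I * σ * (w s / deriv w 0) ∈ Complex.slitPlane := by
  have hσ0 : σ ≠ 0 := by rintro rfl; simp at hσ
  by_cases hs0 : s = 0
  · left
    simpa [hs0, h0] using hδ.resolve_right (by simp [hs0])
  · right
    have h := le_mul_re_div_deriv hw h0 hη hs
    have h1 : 0 < s ^ 2 := by positivity
    have h2 : (w s / deriv w 0).re ≠ 0 := by
      intro h'
      rw [h', mul_zero] at h
      linarith
    simpa [Complex.add_im, Complex.mul_im, Complex.mul_re] using ⟨hσ0, h2⟩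

/-- Near one of its points, `log (δ + iσ w / w'(0))` is an antiderivative of `w' / (w - iσδ w'(0))`
along the curve. -/
theorem integral_deriv_div_sub_eq_log (hw : ContDiff ℝ 1 w) (h0 : w 0 = 0)
    (hT : deriv w 0 ≠ 0)
    (hη : ∀ s, |s| ≤ η → ‖deriv w s / deriv w 0 - 1‖ ≤ 1 / 4) {σ : ℝ} (hσ : σ * σ = 1)
    {δ a b : ℝ} (hab : ∀ s ∈ uIcc a b, |s| ≤ η) (hδ : ∀ s ∈ uIcc a b, 0 < δ ∨ s ≠ 0) :
    ∫ s in a..b, deriv w s / (w s - Complex.I * σ * δ * deriv w 0) =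
      Complex.log (δ + Complex.I * σ * (w b / deriv w 0)) -
        Complex.log (δ + Complex.I * σ * (w a / deriv w 0)) := by
  set T := deriv w 0 with hTdef
  have hσ' : (σ : ℂ) * σ = 1 := by exact_mod_cast hσ
  have hslit : ∀ s ∈ uIcc a b, (δ : ℂ) + Complex.I * σ * (w s / T) ∈ Complex.slitPlane :=
    fun s hs => add_I_mul_mem_slitPlane hw h0 hη hσ (hab s hs) (hδ s hs)
  -- The constant factor `iσ / T` does not affect the logarithmic derivative, and since `σ² = 1` it
  -- sends the pole term to `δ`.
  have hfac : ∀ s, Complex.I * σ * (w s - Complex.I * σ * δ * T) / T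
      = δ + Complex.I * σ * (w s / T) := by
    intro s
    field_simp
    linear_combination (-(T * δ * (Complex.I ^ 2))) * hσ' - T * δ * Complex.I_sq
  have hne : ∀ s ∈ uIcc a b, w s - Complex.I * σ * δ * T ≠ 0 := by
    intro s hs h
    have h1 := Complex.slitPlane_ne_zero (hslit s hs)
    rw [← hfac, h] at h1
    simp at h1
  refine intervalIntegral.integral_eq_sub_of_hasDerivAt
    (f := fun s => Complex.log (δ + Complex.I * σ * (w s / T))) (fun s hs => ?_) ?_
  · have hd : HasDerivAt (fun s => (δ : ℂ) + Complex.I * σ * (w s / T))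
        (Complex.I * σ * (deriv w s / T)) s :=
      ((((hw.differentiable one_ne_zero) s).hasDerivAt.div_const T).const_mul _).const_add _
    have h1 := hd.clog_real (hslit s hs)
    have hσ0 : (σ : ℂ) ≠ 0 := by
      intro h
      rw [h] at hσ'
      simp at hσ'
    have e : deriv w s / (w s - Complex.I * σ * δ * T) =
        Complex.I * σ * (deriv w s / T) / (δ + Complex.I * σ * (w s / T)) := by
      rw [← hfac]
      have := hne s hs
      field_simp
    rw [e]
    exact h1
  · exact ((hw.continuous_deriv le_rfl).continuousOn.div
      (hw.continuous.sub continuous_const).continuousOn hne).intervalIntegrable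

end LocalLog

/-- The Cauchy principal value of `∫ dτ / (τ - t)` over a closed curve that winds at most once
around the points of its complement, for a point `t` of the curve. -/
theorem tendsto_principal_value {w : ℝ → ℂ} (hw : ContDiff ℝ 1 w) (h0 : w 0 = 0)
    (hper : Function.Periodic w 1) {η : ℝ}
    (hη0 : 0 < η) (hη1 : η < 1 / 2) (hT : deriv w 0 ≠ 0)
    (hη : ∀ s, |s| ≤ η → ‖deriv w s / deriv w 0 - 1‖ ≤ 1 / 4)
    (hne : ∀ s, |s| ≤ 1 / 2 → s ≠ 0 → w s ≠ 0)
    (hN : ∀ z ∉ range w, ∫ s in (-(1 / 2) : ℝ)..(1 / 2), deriv w s / (w s - z) ∈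
      ({0, 2 * Real.pi * Complex.I} : Set ℂ))
    {sm sp : ℝ → ℝ} (hsm : Tendsto sm (𝓝[>] 0) (𝓝[<] 0)) (hsp : Tendsto sp (𝓝[>] 0) (𝓝[>] 0))
    (hs : ∀ᶠ ε in 𝓝[>] 0, sm ε ∈ Ioo (-η) 0 ∧ sp ε ∈ Ioo 0 η ∧ ‖w (sm ε)‖ = ‖w (sp ε)‖) :
    Tendsto (fun ε => (∫ s in (-(1 / 2) : ℝ)..sm ε, deriv w s / w s) +
      ∫ s in sp ε..(1 / 2), deriv w s / w s) (𝓝[>] 0) (𝓝 (Real.pi * Complex.I)) := by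
  have hw' : Continuous (deriv w) := hw.continuous_deriv le_rfl
  set T := deriv w 0 with hTdef
  set ℓ : ℝ → ℝ → ℂ := fun σ s => Complex.log (Complex.I * σ * (w s / T)) with hℓ
  have hη1' : -(1 / 2) ≤ -η := by linarith
  have habs : |η| = η := abs_of_pos hη0
  have hun : ∀ s ∈ uIcc (-(1 / 2)) (-η), w s ≠ 0 := by
    intro s hs
    rw [uIcc_of_le hη1'] at hs
    exact hne s (abs_le.2 ⟨hs.1, by linarith [hs.2]⟩) (by linarith [hs.2])
  have hup : ∀ s ∈ uIcc η (1 / 2), w s ≠ 0 := by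
    intro s hs
    rw [uIcc_of_le hη1.le] at hs
    exact hne s (abs_le.2 ⟨by linarith [hs.1], hs.2⟩) (by linarith [hs.1])
  set F : ℂ := (∫ s in (-(1 / 2) : ℝ)..-η, deriv w s / w s) + ∫ s in η..(1 / 2), deriv w s / w s
    with hF
  have hnear : ∀ s ∈ uIcc (-η) η, |s| ≤ η := fun s hs => by
    rw [uIcc_of_le (by linarith)] at hs
    exact abs_le.2 hs
  have hz : ∀ σ : ℝ, Tendsto (fun δ : ℝ => Complex.I * σ * δ * T) (𝓝[>] 0) (𝓝 0) := by
    intro σ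
    have : Continuous fun δ : ℝ => Complex.I * σ * δ * T := by fun_prop
    have h := this.tendsto 0
    simp only [Complex.ofReal_zero, mul_zero, zero_mul] at h
    exact h.mono_left nhdsWithin_le_nhds
  -- The test points `iσδT` approach the origin along the normal, from the left for `σ = 1` and from
  -- the right for `σ = -1`. The far arcs avoid them by compactness, the near arc by the slit plane
  -- condition.
  have hoff : ∀ σ : ℝ, σ * σ = 1 → ∀ᶠ δ : ℝ in 𝓝[>] 0, Complex.I * σ * δ * T ∉ range w := by
    intro σ hσ
    have hfar : ∀ᶠ z in 𝓝 (0 : ℂ), z ∉ w '' uIcc (-(1 / 2)) (-η) ∪ w '' uIcc η (1 / 2) := by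
      refine IsOpen.mem_nhds (((isCompact_uIcc.image hw.continuous).union
        (isCompact_uIcc.image hw.continuous)).isClosed.isOpen_compl) ?_
      rintro (⟨s, hs, h⟩ | ⟨s, hs, h⟩)
      · exact hun s hs h
      · exact hup s hs h
    filter_upwards [(hz σ).eventually hfar, self_mem_nhdsWithin] with δ h1 hδ hmem
    rw [← hper.image_Icc one_pos (-(1 / 2))] at hmem
    obtain ⟨s, hs, hsw⟩ := hmem
    rw [uIcc_of_le hη1', uIcc_of_le hη1.le] at h1
    rcases lt_or_ge s (-η) with h2 | h2
    · exact h1 (Or.inl ⟨s, ⟨hs.1, h2.le⟩, hsw⟩)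
    rcases lt_or_ge η s with h3 | h3
    · exact h1 (Or.inr ⟨s, ⟨h3.le, by linarith [hs.2]⟩, hsw⟩)
    have h4 := add_I_mul_mem_slitPlane hw h0 hη hσ (δ := δ) (abs_le.2 ⟨h2, h3⟩) (Or.inl hδ)
    refine Complex.slitPlane_ne_zero h4 ?_
    rw [hsw, mul_div_cancel_right₀ _ hT]
    have hσ' : (σ : ℂ) * σ = 1 := by exact_mod_cast hσ
    linear_combination (δ * Complex.I ^ 2) * hσ' + δ * Complex.I_sq
  -- The winding number about `iσδT` is split into the far arcs and an explicit logarithm on the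
  -- near arc; its limit as `δ → 0` stays in the closed set `{0, 2πi}`.
  have hA : ∀ σ : ℝ, σ * σ = 1 → F + (ℓ σ η - ℓ σ (-η)) ∈
      ({0, 2 * Real.pi * Complex.I} : Set ℂ) := by
    intro σ hσ
    have hlog : ∀ s, |s| ≤ η → s ≠ 0 → Tendsto
        (fun δ : ℝ => Complex.log (δ + Complex.I * σ * (w s / T))) (𝓝[>] 0) (𝓝 (ℓ σ s)) := by
      intro s hs hs0
      have h1 := add_I_mul_mem_slitPlane hw h0 hη hσ (δ := 0) hs (Or.inr hs0)
      rw [Complex.ofReal_zero, zero_add] at h1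
      have h2 : Continuous fun δ : ℝ => (δ : ℂ) + Complex.I * σ * (w s / T) := by fun_prop
      have h3 := h2.tendsto 0
      rw [Complex.ofReal_zero, zero_add] at h3
      exact (h3.mono_left nhdsWithin_le_nhds).clog h1
    have hlim := (((tendsto_integral_div_sub hw.continuous hw' hun).comp (hz σ)).add
      ((tendsto_integral_div_sub hw.continuous hw' hup).comp (hz σ))).add
      ((hlog η habs.le hη0.ne').sub (hlog (-η) (by rw [abs_neg, habs]) (by linarith)))
    refine (Set.toFinite _).isClosed.mem_of_tendsto hlim ?_
    filter_upwards [hoff σ hσ, self_mem_nhdsWithin] with δ h1 hδ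
    have h2 := hN _ h1
    have hint : ∀ a b, IntervalIntegrable
        (fun s => deriv w s / (w s - Complex.I * σ * δ * T)) volume a b := fun a b =>
      (hw'.div (hw.continuous.sub continuous_const)
        fun s h => h1 ⟨s, sub_eq_zero.1 h⟩).intervalIntegrable a b
    rw [← intervalIntegral.integral_add_adjacent_intervals (hint _ (-η)) (hint (-η) (1 / 2)),
      ← intervalIntegral.integral_add_adjacent_intervals (hint (-η) η) (hint η (1 / 2)),
      integral_deriv_div_sub_eq_log hw h0 hT hη hσ hnear (fun _ _ => Or.inl hδ)] at h2
    convert h2 using 1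
    simp only [Function.comp]
    ring
  have him : ∀ s, |s| ≤ η → s * (Complex.I * (w s / T)).im ≥ 3 / 4 * s ^ 2 := fun s hs => by
    simpa using le_mul_re_div_deriv hw h0 hη hs
  -- Passing from `σ = 1` to `σ = -1` lowers the value by `2πi`, a loss of `πi` at each end. Both
  -- values lie in `{0, 2πi}`, so the one on the left must be `2πi`.
  have hA₁ : F + (ℓ 1 η - ℓ 1 (-η)) = 2 * Real.pi * Complex.I := by
    have h1 := hA 1 (by norm_num)
    have h2 := hA (-1) (by norm_num)
    have e1 : ℓ (-1) η = ℓ 1 η - Real.pi * Complex.I := by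
      have := him η habs.le
      have h3 : 0 < (Complex.I * (w η / T)).im := by
        by_contra! h
        nlinarith [mul_nonpos_of_nonneg_of_nonpos hη0.le h, pow_pos hη0 2]
      have := Complex.log_neg_of_im_pos h3
      simpa [hℓ] using this
    have e2 : ℓ 1 (-η) = ℓ (-1) (-η) - Real.pi * Complex.I := by
      have := him (-η) (by rw [abs_neg, habs])
      have h3 : 0 < (-(Complex.I * (w (-η) / T))).im := by
        rw [Complex.neg_im]
        by_contra! h
        nlinarith [mul_nonpos_of_nonneg_of_nonpos hη0.le h, pow_pos hη0 2]
      have := Complex.log_neg_of_im_pos h3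
      simpa [hℓ] using this
    rcases h1 with h1 | h1
    · exfalso
      rw [e1] at h2
      rw [e2] at h1
      have h3 : F + (ℓ 1 η - Real.pi * Complex.I - ℓ (-1) (-η)) = -(2 * Real.pi * Complex.I) := by
        linear_combination h1
      rw [h3] at h2
      have hpi : (2 * Real.pi * Complex.I : ℂ) ≠ 0 := Complex.two_pi_I_ne_zero
      rcases h2 with h2 | h2
      · exact hpi (neg_eq_zero.1 h2)
      · rw [mem_singleton_iff] at h2
        exact hpi (self_eq_neg.1 h2.symm)
    · exact h1
  -- The end points of the cut have equal modulus, so the real parts of the logarithms cancel and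
  -- only a difference of arguments remains. These tend to `-π/2` and `π/2`, which takes `πi` off
  -- `2πi`.
  have hcut : ∀ᶠ ε in 𝓝[>] (0 : ℝ), (∫ s in (-(1 / 2) : ℝ)..sm ε, deriv w s / w s) +
      (∫ s in sp ε..(1 / 2), deriv w s / w s) = 2 * Real.pi * Complex.I +
        (Complex.arg (Complex.I * (w (sm ε) / T)) - Complex.arg (Complex.I * (w (sp ε) / T)))
          * Complex.I := by
    filter_upwards [hs] with ε ⟨h1, h2, h3⟩
    have hnm : ∀ s ∈ uIcc (-η) (sm ε), |s| ≤ η ∧ s ≠ 0 := by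
      intro s hs
      rw [uIcc_of_le h1.1.le] at hs
      exact ⟨abs_le.2 ⟨hs.1, by linarith [hs.2, h1.2]⟩, by linarith [hs.2, h1.2]⟩
    have hnp : ∀ s ∈ uIcc (sp ε) η, |s| ≤ η ∧ s ≠ 0 := by
      intro s hs
      rw [uIcc_of_le h2.2.le] at hs
      exact ⟨abs_le.2 ⟨by linarith [hs.1, h2.1], hs.2⟩, by linarith [hs.1, h2.1]⟩
    have hint : ∀ a b, (∀ s ∈ uIcc a b, w s ≠ 0) → IntervalIntegrable
        (fun s => deriv w s / w s) volume a b := fun a b h =>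
      (hw'.continuousOn.div hw.continuous.continuousOn h).intervalIntegrable
    have hnz : ∀ s, |s| ≤ η → s ≠ 0 → w s ≠ 0 := fun s h => hne s (h.trans hη1.le)
    have i1 := integral_deriv_div_sub_eq_log hw h0 hT hη (σ := 1) (by norm_num) (δ := 0)
      (fun s hs => (hnm s hs).1) (fun s hs => Or.inr (hnm s hs).2)
    have i2 := integral_deriv_div_sub_eq_log hw h0 hT hη (σ := 1) (by norm_num) (δ := 0)
      (fun s hs => (hnp s hs).1) (fun s hs => Or.inr (hnp s hs).2)
    simp only [Complex.ofReal_zero, Complex.ofReal_one, mul_zero, zero_mul, sub_zero, zero_add,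
      mul_one] at i1 i2
    rw [← intervalIntegral.integral_add_adjacent_intervals (hint _ _ hun)
      (hint _ _ fun s hs => hnz s (hnm s hs).1 (hnm s hs).2),
      ← intervalIntegral.integral_add_adjacent_intervals
      (hint _ _ fun s hs => hnz s (hnp s hs).1 (hnp s hs).2) (hint _ _ hup), i1, i2, ← hA₁]
    have h4 : ‖Complex.I * (w (sm ε) / T)‖ = ‖Complex.I * (w (sp ε) / T)‖ := by
      simp only [norm_mul, norm_div, h3]
    have h5 : Complex.log (Complex.I * (w (sm ε) / T)) - Complex.log (Complex.I * (w (sp ε) / T))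
        = (Complex.arg (Complex.I * (w (sm ε) / T)) - Complex.arg (Complex.I * (w (sp ε) / T)))
          * Complex.I := by
      rw [Complex.log, Complex.log, h4]
      ring
    rw [← h5]
    simp only [hℓ, hF, Complex.ofReal_one, mul_one]
    ring
  have hslope : Tendsto (fun s : ℝ => (s : ℂ)⁻¹ * (w s / T)) (𝓝[≠] 0) (𝓝 1) := by
    have h := ((hw.differentiable one_ne_zero) 0).hasDerivAt.div_const T
    have h1 := h.tendsto_slope
    rw [← hTdef, div_self hT] at h1
    refine h1.congr fun s => ?_
    simp [slope_def_module, h0]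
  have hargp : Tendsto (fun ε => Complex.arg (Complex.I * (w (sp ε) / T))) (𝓝[>] 0)
      (𝓝 (Real.pi / 2)) := by
    have h1 := (hslope.comp (hsp.mono_right (nhdsWithin_mono _ fun x hx => ne_of_gt hx))).const_mul
      Complex.I
    have h2 := (Complex.continuousAt_arg (x := Complex.I * 1)
      (by simp [Complex.mem_slitPlane_iff])).tendsto.comp h1
    rw [mul_one, Complex.arg_I] at h2
    refine h2.congr' ?_
    filter_upwards [hs] with ε hε
    have h3 := hε.2.1
    simp only [Function.comp]
    rw [← Complex.arg_real_mul (Complex.I * (w (sp ε) / T)) (inv_pos.2 h3.1)]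
    push_cast
    ring_nf
  have hargm : Tendsto (fun ε => Complex.arg (Complex.I * (w (sm ε) / T))) (𝓝[>] 0)
      (𝓝 (-(Real.pi / 2))) := by
    have h1 := (hslope.comp (hsm.mono_right (nhdsWithin_mono _ fun x hx => ne_of_lt hx))).const_mul
      (-Complex.I)
    have h2 := (Complex.continuousAt_arg (x := -Complex.I * 1)
      (by simp [Complex.mem_slitPlane_iff])).tendsto.comp h1
    rw [mul_one, Complex.arg_neg_I] at h2
    refine h2.congr' ?_
    filter_upwards [hs] with ε hε
    have h3 := hε.1
    simp only [Function.comp]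
    rw [← Complex.arg_real_mul (Complex.I * (w (sm ε) / T)) (inv_pos.2 (neg_pos.2 h3.2))]
    push_cast
    rw [inv_neg]
    ring_nf
  have hlim : Tendsto (fun ε => 2 * Real.pi * Complex.I +
        (Complex.arg (Complex.I * (w (sm ε) / T)) - Complex.arg (Complex.I * (w (sp ε) / T)))
          * Complex.I) (𝓝[>] 0)
      (𝓝 (2 * Real.pi * Complex.I + (((-(Real.pi / 2) : ℝ) : ℂ) - ((Real.pi / 2 : ℝ) : ℂ))
        * Complex.I)) :=
    ((((Complex.continuous_ofReal.tendsto _).comp hargm).sub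
      ((Complex.continuous_ofReal.tendsto _).comp hargp)).mul_const _).const_add _
  have hval : 2 * Real.pi * Complex.I + (((-(Real.pi / 2) : ℝ) : ℂ) - ((Real.pi / 2 : ℝ) : ℂ))
        * Complex.I = Real.pi * Complex.I := by
    push_cast
    ring
  rw [hval] at hlim
  exact hlim.congr' (hcut.mono fun ε h => h.symm)

/-! ### Expansion in the signed distance and end point terms -/

/-- Smoothness of `s ↦ ∫₀¹ u ^ j f (u s) du`. -/
theorem contDiff_integral_pow_mul_comp_mul {n : ℕ} : ∀ {f : ℝ → ℂ}, ContDiff ℝ n f → ∀ j : ℕ,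
    ContDiff ℝ n fun s : ℝ => ∫ u in (0 : ℝ)..1, (u : ℂ) ^ j * f (u * s) := by
  -- Differentiation replaces `u ^ j f` by `u ^ (j + 1) f'`, so the induction runs over all `f` and
  -- `j` at once.
  induction n with
  | zero =>
    intro f hf j
    have hfc := hf.continuous
    rw [Nat.cast_zero, contDiff_zero]
    exact intervalIntegral.continuous_parametric_intervalIntegral_of_continuous' (by fun_prop) _ _
  | succ n ih =>
    intro f hf j
    have hfc := hf.continuous
    have hf' := hf
    rw [Nat.cast_add, Nat.cast_one, contDiff_succ_iff_deriv] at hf' ⊢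
    have hdc : Continuous (deriv f) := hf'.2.2.continuous
    have hder : ∀ s : ℝ, HasDerivAt (fun s : ℝ => ∫ u in (0 : ℝ)..1, (u : ℂ) ^ j * f (u * s))
        (∫ u in (0 : ℝ)..1, (u : ℂ) ^ (j + 1) * deriv f (u * s)) s := by
      intro s
      obtain ⟨M, hM⟩ := (isCompact_closedBall (0 : ℝ) (|s| + 1)).exists_bound_of_continuousOn
        hdc.continuousOn
      refine (intervalIntegral.hasDerivAt_integral_of_dominated_loc_of_deriv_le
        (F' := fun s u => (u : ℂ) ^ (j + 1) * deriv f (u * s)) (bound := fun _ => M)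
        (Metric.ball_mem_nhds s one_pos) ?_ ?_ ?_ ?_ intervalIntegrable_const ?_).2
      · exact Eventually.of_forall fun r => Continuous.aestronglyMeasurable (by fun_prop)
      · exact Continuous.intervalIntegrable (by fun_prop) _ _
      · exact Continuous.aestronglyMeasurable (by fun_prop)
      · refine Eventually.of_forall fun u hu r hr => ?_
        rw [uIoc_of_le zero_le_one] at hu
        have hu1 : ‖(u : ℂ) ^ (j + 1)‖ ≤ 1 := by
          rw [norm_pow, Complex.norm_real, Real.norm_of_nonneg hu.1.le]
          exact pow_le_one₀ hu.1.le hu.2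
        have hr1 : |r| ≤ |s| + 1 := by
          rw [Metric.mem_ball, Real.dist_eq] at hr
          linarith [abs_sub_abs_le_abs_sub r s]
        have h2 : ‖deriv f (u * r)‖ ≤ M := hM _ (by
          rw [mem_closedBall_zero_iff, Real.norm_eq_abs, abs_mul, abs_of_pos hu.1]
          exact (mul_le_of_le_one_left (abs_nonneg r) hu.2).trans hr1)
        rw [norm_mul]
        exact (mul_le_of_le_one_left (norm_nonneg _) hu1).trans h2
      · refine Eventually.of_forall fun u _ r _ => ?_
        have h1 : HasDerivAt (fun r : ℝ => u * r) u r := by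
          simpa using (hasDerivAt_id r).const_mul u
        have h2 := ((hf'.1 (u * r)).hasDerivAt.scomp r h1).const_mul ((u : ℂ) ^ j)
        refine h2.congr_deriv ?_
        rw [Complex.real_smul]
        ring
    refine ⟨fun s => (hder s).differentiableAt, by simp, ?_⟩
    rw [funext fun s => (hder s).deriv]
    exact ih hf'.2.2 (j + 1)

/-- Hadamard's lemma for a smooth curve through the origin. -/
theorem exists_contDiff_eq_mul {n : ℕ} {w : ℝ → ℂ} (hw : ContDiff ℝ (n + 1 : ℕ) w)
    (h0 : w 0 = 0) :
    ∃ g : ℝ → ℂ, ContDiff ℝ n g ∧ g 0 = deriv w 0 ∧ ∀ s : ℝ, w s = s * g s := by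
  have hw' := hw
  rw [Nat.cast_add, Nat.cast_one, contDiff_succ_iff_deriv] at hw'
  refine ⟨fun s => ∫ u in (0 : ℝ)..1, (u : ℂ) ^ 0 * deriv w (u * s),
    contDiff_integral_pow_mul_comp_mul hw'.2.2 0, by simp, fun s => ?_⟩
  have hdc : Continuous (deriv w) := hw'.2.2.continuous
  have h := intervalIntegral.integral_eq_sub_of_hasDerivAt (a := 0) (b := 1)
    (f := fun u : ℝ => w (u * s)) (f' := fun u => (s : ℂ) * deriv w (u * s))
    (fun u _ => by
      have h1 : HasDerivAt (fun u : ℝ => u * s) s u := by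
        simpa using (hasDerivAt_id u).mul_const s
      have h2 := (hw'.1 (u * s)).hasDerivAt.scomp u h1
      rwa [Complex.real_smul] at h2)
    (Continuous.intervalIntegrable (by fun_prop) _ _)
  rw [intervalIntegral.integral_const_mul, one_mul, zero_mul, h0, sub_zero] at h
  simpa using h.symm

theorem ContDiffAt.exists_taylor_tendsto {n : ℕ} {V : ℝ → ℂ} (hV : ContDiffAt ℝ n V 0) :
    ∃ c : ℕ → ℂ, Tendsto
      (fun r : ℝ => ((r : ℂ) ^ n)⁻¹ * (V r - ∑ j ∈ Finset.range (n + 1), c j * (r : ℂ) ^ j))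
      (𝓝 0) (𝓝 0) := by
  obtain ⟨u, hu, hVu⟩ := hV.contDiffOn le_rfl (by simp)
  obtain ⟨R, hR, hsub⟩ := Metric.mem_nhds_iff.1 hu
  have hVb : ContDiffOn ℝ n V (Metric.ball 0 R) := hVu.mono hsub
  have h := taylor_tendsto (convex_ball (0 : ℝ) R) (Metric.mem_ball_self hR) hVb
  rw [nhdsWithin_eq_nhds.2 (Metric.ball_mem_nhds _ hR)] at h
  refine ⟨fun j => ((j.factorial : ℝ)⁻¹ : ℝ) * iteratedDerivWithin j V (Metric.ball 0 R) 0,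
    h.congr fun r => ?_⟩
  rw [taylor_within_apply, sub_zero, Complex.real_smul]
  congr 1
  · push_cast
    rfl
  · congr 1
    refine Finset.sum_congr rfl fun j _ => ?_
    rw [Complex.real_smul]
    push_cast
    ring

/-- Along a smooth regular curve `w`, the function `w ^ (-n)` is, up to a smooth factor, the power
`r ^ (-n)` of the signed distance `r` to the origin. -/
theorem exists_contDiffAt_inv_pow {n : ℕ} (hn : n ≠ 0) {w : ℝ → ℂ}
    (hw : ContDiff ℝ (n + 1 : ℕ) w) (h0 : w 0 = 0) (hT : deriv w 0 ≠ 0) :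
    ∃ V : ℝ → ℂ, ContDiffAt ℝ n V 0 ∧
      (∀ᶠ s in 𝓝[>] 0, (w s ^ n)⁻¹ = ((‖w s‖ : ℂ) ^ n)⁻¹ * V ‖w s‖) ∧
      (∀ᶠ s in 𝓝[<] 0, (w s ^ n)⁻¹ = ((-‖w s‖ : ℂ) ^ n)⁻¹ * V (-‖w s‖)) := by
  obtain ⟨g, hg, hg0, hwg⟩ := exists_contDiff_eq_mul hw h0
  rw [← hg0] at hT
  have hn' : (n : WithTop ℕ∞) ≠ 0 := by exact_mod_cast hn
  have hgn : ContDiffAt ℝ n (fun s => ‖g s‖) 0 := hg.contDiffAt.norm ℝ hT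
  -- With `w = s g`, `ρ` is the distance to the origin signed by `s`. Since `ρ'(0) = ‖g 0‖ ≠ 0`, it
  -- has a local inverse `σ` of class `C^n` and can serve as parameter; passing from `w` to `g`
  -- costs one derivative.
  set ρ : ℝ → ℝ := fun s => s * ‖g s‖ with hρ
  have hρc : ContDiffAt ℝ n ρ 0 := contDiffAt_id.mul hgn
  have hρd : HasDerivAt ρ ‖g 0‖ 0 := by
    have h : HasDerivAt ρ _ 0 := (hasDerivAt_id (0 : ℝ)).mul (hgn.differentiableAt hn').hasDerivAt
    simpa using h
  have hρ0 : ρ 0 = 0 := by simp [hρ]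
  have hT' : ‖g 0‖ ≠ 0 := norm_ne_zero_iff.2 hT
  have hρf := hρd.hasFDerivAt_equiv hT'
  set σ := hρc.localInverse hρf hn' with hσ
  have hσc : ContDiffAt ℝ n σ 0 := by
    have := hρc.to_localInverse hρf hn'
    rwa [hρ0] at this
  have hσ0 : σ 0 = 0 := by
    have := hρc.localInverse_apply_image hρf hn'
    rwa [hρ0] at this
  have hinv : ∀ᶠ s in 𝓝 (0 : ℝ), σ (ρ s) = s :=
    (hρc.hasStrictFDerivAt' hρf hn').eventually_left_inverse
  have hgne : ∀ᶠ s in 𝓝 (0 : ℝ), g s ≠ 0 := hg.continuous.continuousAt.eventually_ne hT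
  have hkey : ∀ᶠ s in 𝓝 (0 : ℝ), s ≠ 0 →
      (w s ^ n)⁻¹ = ((ρ s : ℂ) ^ n)⁻¹ * ((‖g (σ (ρ s))‖ : ℂ) * (g (σ (ρ s)))⁻¹) ^ n := by
    filter_upwards [hinv, hgne] with s h1 h2 h3
    have h4 : (‖g s‖ : ℂ) ≠ 0 := by exact_mod_cast norm_ne_zero_iff.2 h2
    have h5 : (s : ℂ) ≠ 0 := by exact_mod_cast h3
    rw [h1, hwg, hρ, ← inv_pow, ← inv_pow, ← mul_pow]
    congr 1
    push_cast
    field_simp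
  refine ⟨fun r => ((‖g (σ r)‖ : ℂ) * (g (σ r))⁻¹) ^ n, ?_, ?_, ?_⟩
  · have hgσ : ContDiffAt ℝ n (fun r => g (σ r)) 0 :=
      hg.contDiffAt.comp 0 hσc
    have hne : g (σ 0) ≠ 0 := by rwa [hσ0]
    exact ((Complex.ofRealCLM.contDiff.contDiffAt.comp 0 (hgσ.norm ℝ hne)).mul
      (hgσ.inv hne)).pow n
  · filter_upwards [hkey.filter_mono nhdsWithin_le_nhds, self_mem_nhdsWithin] with s h1 hs
    have h2 : ρ s = ‖w s‖ := by
      rw [hwg, norm_mul, Complex.norm_real, Real.norm_of_nonneg (le_of_lt hs)]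
    rw [h1 (ne_of_gt hs), h2]
  · filter_upwards [hkey.filter_mono nhdsWithin_le_nhds, self_mem_nhdsWithin] with s h1 hs
    have h2 : ρ s = -‖w s‖ := by
      rw [hwg, norm_mul, Complex.norm_real, Real.norm_of_nonpos (le_of_lt hs), neg_mul, neg_neg]
    rw [h1 (ne_of_lt hs), h2]
    push_cast
    rfl

/-- The end point contributions of `∫ dτ / (τ - t) ^ (n + 1)` have no finite part. -/
theorem exists_tendsto_inv_pow_sub_inv_pow {n : ℕ} (hn : n ≠ 0) {w : ℝ → ℂ}
    (hw : ContDiff ℝ (n + 1 : ℕ) w) (h0 : w 0 = 0) (hT : deriv w 0 ≠ 0)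
    {sm sp : ℝ → ℝ} (hsm : Tendsto sm (𝓝[>] 0) (𝓝[<] 0)) (hsp : Tendsto sp (𝓝[>] 0) (𝓝[>] 0))
    (hs : ∀ᶠ ε in 𝓝[>] 0, ‖w (sm ε)‖ = ε ∧ ‖w (sp ε)‖ = ε) :
    ∃ ξ ∈ Polynomial.degreeLT ℂ n, Tendsto (fun ε : ℝ =>
      (w (sm ε) ^ n)⁻¹ - (w (sp ε) ^ n)⁻¹ + ξ.eval (ε : ℂ) / (ε : ℂ) ^ n) (𝓝[>] 0) (𝓝 0) := by
  obtain ⟨V, hV, hVp, hVm⟩ := exists_contDiffAt_inv_pow hn hw h0 hT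
  obtain ⟨c, hc⟩ := hV.exists_taylor_tendsto
  -- A Taylor term `c j * r ^ (j - n)` contributes `((-1) ^ (j + n) - 1) * c j * ε ^ (j - n)` to the
  -- difference of its values at `-ε` and `ε`. `ξ` cancels these for `j < n`; for `j = n` the
  -- contribution is already zero.
  refine ⟨∑ j ∈ Finset.range n, Polynomial.monomial j ((1 - (-1) ^ (j + n)) * c j),
    Submodule.sum_mem _ fun j hj => Polynomial.mem_degreeLT.2
      ((Polynomial.degree_monomial_le _ _).trans_lt (by exact_mod_cast Finset.mem_range.1 hj)), ?_⟩
  have hneg : Tendsto (fun ε : ℝ => -ε) (𝓝[>] 0) (𝓝 0) := by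
    have h := (continuous_neg (G := ℝ)).tendsto 0
    rw [neg_zero] at h
    exact h.mono_left nhdsWithin_le_nhds
  have hlim := (hc.comp hneg).sub (hc.mono_left (nhdsWithin_le_nhds (s := Ioi (0 : ℝ))))
  rw [sub_zero] at hlim
  refine hlim.congr' ?_
  filter_upwards [hsm.eventually hVm, hsp.eventually hVp, hs, self_mem_nhdsWithin]
    with ε h1 h2 h3 hε
  rw [h1, h2, h3.1, h3.2]
  have hε' : (ε : ℂ) ≠ 0 := by exact_mod_cast (ne_of_gt hε)
  have hsq : ((-1 : ℂ) ^ n) * (-1) ^ n = 1 := by rw [← mul_pow]; simp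
  have hsum : ∀ r : ℂ, ∑ j ∈ Finset.range (n + 1), c j * r ^ j
      = ∑ j ∈ Finset.range n, c j * r ^ j + c n * r ^ n := fun r => Finset.sum_range_succ _ _
  simp only [Function.comp, hsum, Complex.ofReal_neg]
  rw [Polynomial.eval_finsetSum]
  simp only [Polynomial.eval_monomial]
  have e1 : ((-(ε : ℂ)) ^ n)⁻¹ = (-1) ^ n * ((ε : ℂ) ^ n)⁻¹ := by
    rw [neg_pow, mul_inv, ← inv_pow]
    norm_num
  have e2 : ∑ j ∈ Finset.range n, (1 - (-1) ^ (j + n)) * c j * (ε : ℂ) ^ j =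
      ∑ j ∈ Finset.range n, c j * (ε : ℂ) ^ j
        - (-1) ^ n * ∑ j ∈ Finset.range n, c j * (-(ε : ℂ)) ^ j := by
    rw [Finset.mul_sum, ← Finset.sum_sub_distrib]
    refine Finset.sum_congr rfl fun j _ => ?_
    rw [neg_pow (ε : ℂ) j, pow_add]
    ring
  rw [e2, e1, neg_pow (ε : ℂ) n]
  have hεn : (ε : ℂ) ^ n ≠ 0 := pow_ne_zero _ hε'
  field_simp
  linear_combination (-(c n * (ε : ℂ) ^ n)) * hsq

/-! ### Closed contours cut near one of their points -/

theorem Function.Periodic.integral_comp_add_left_eq {F : ℝ → ℂ} (hF : Function.Periodic F 1)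
    (s₀ : ℝ) : ∫ s in (-(1 / 2) : ℝ)..(1 / 2), F (s₀ + s) = ∫ s in (0 : ℝ)..1, F s := by
  rw [intervalIntegral.integral_comp_add_left]
  have h := hF.intervalIntegral_add_eq (s₀ + -(1 / 2)) 0
  rw [zero_add] at h
  rw [← h]
  congr 1
  ring

namespace ClosedContour

variable {p : ℕ} (γ : ClosedContour p)

theorem contDiff_one (hp : 1 ≤ p) : ContDiff ℝ 1 γ.toFun :=
  γ.contDiff.of_le (by exact_mod_cast hp)

theorem isCompact_carrier (hp : 1 ≤ p) : IsCompact γ.carrier := by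
  rw [carrier, ← γ.periodic.image_Icc one_pos 0]
  exact isCompact_Icc.image (γ.contDiff_one hp).continuous

theorem deriv_periodic : Function.Periodic (deriv γ.toFun) 1 := fun s => by
  rw [← deriv_comp_add_const, funext γ.periodic]

/-- Parameters of the same point have equal fractional parts, hence differ by an integer, and the
only integer of modulus at most `1/2` is `0`. -/
theorem apply_add_ne {s₀ s : ℝ} (hs : |s| ≤ 1 / 2) (h0 : s ≠ 0) :
    γ.toFun (s₀ + s) ≠ γ.toFun s₀ := by
  have hfr : ∀ x, γ.toFun (Int.fract x) = γ.toFun x := fun x => by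
    have := γ.periodic.sub_zsmul_eq ⌊x⌋ (x := x)
    rwa [zsmul_one] at this
  intro h
  rw [← hfr, ← hfr s₀] at h
  have h1 := γ.injOn ⟨Int.fract_nonneg _, Int.fract_lt_one _⟩
    ⟨Int.fract_nonneg _, Int.fract_lt_one _⟩ h
  obtain ⟨z, hz⟩ := Int.fract_eq_fract.1 h1
  rw [add_sub_cancel_left] at hz
  rw [hz] at hs h0
  have h2 : |z| < 1 := by
    have : (|z| : ℝ) < 1 := by linarith
    exact_mod_cast this
  rw [Int.abs_lt_one_iff] at h2
  exact h0 (by simp [h2])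

theorem measurableSet_cutParams (hp : 1 ≤ p) (t : ℂ) (ε : ℝ) :
    MeasurableSet (γ.cutParams t ε) :=
  measurableSet_Ico.inter (isClosed_le continuous_const
    ((γ.contDiff_one hp).continuous.sub continuous_const).norm).measurableSet

theorem cutParams_subset (t : ℂ) (ε : ℝ) :
    γ.cutParams t ε ⊆ Icc 0 1 ∩ {s | ε ≤ ‖γ.toFun s - t‖} := fun _ hs =>
  ⟨Ico_subset_Icc_self hs.1, hs.2⟩

theorem integrableOn_hyperIntegrand (hp : 1 ≤ p) {φ : ℂ → ℂ}
    (hφ : Continuous fun s => φ (γ.toFun s)) (k : ℕ) (t : ℂ) {ε : ℝ} (hε : 0 < ε) :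
    IntegrableOn (γ.hyperIntegrand k φ t) (γ.cutParams t ε) := by
  have hc := (γ.contDiff_one hp).continuous.sub (continuous_const (y := t))
  have hK : IsCompact (Icc (0 : ℝ) 1 ∩ {s | ε ≤ ‖γ.toFun s - t‖}) :=
    isCompact_Icc.inter_right (isClosed_le continuous_const hc.norm)
  refine (ContinuousOn.integrableOn_compact hK ?_).mono_set (γ.cutParams_subset t ε)
  refine ((hφ.continuousOn.div (hc.pow k).continuousOn fun s hs => pow_ne_zero k ?_)).mul
    ((γ.contDiff_one hp).continuous_deriv le_rfl).continuousOn
  exact norm_pos_iff.1 (hε.trans_le hs.2)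

/-- Bounded components of the complement are covered by the orientation hypothesis, unbounded ones
by the vanishing of the winding number. The Jordan curve theorem is not needed. -/
theorem winding_mem (hp : 1 ≤ p) (hγ : γ.IsPositivelyOriented) {z : ℂ} (hz : z ∉ γ.carrier) :
    ∫ s in (0 : ℝ)..1, deriv γ.toFun s / (γ.toFun s - z) ∈
      ({0, 2 * Real.pi * Complex.I} : Set ℂ) := by
  by_cases hb : Bornology.IsBounded (connectedComponentIn γ.carrierᶜ z)
  · right
    rw [intervalIntegral.integral_of_le zero_le_one, ← integral_Ico_eq_integral_Ioc]
    exact hγ z ⟨hz, hb⟩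
  · left
    exact winding_eq_zero_of_not_isBounded (γ.contDiff_one hp) γ.periodic
      (γ.isCompact_carrier hp).isClosed hz hb

/-- The contour near its point with parameter `s₀`: parameters `s₀ + sm ε` and `s₀ + sp ε` of the
end points of the arc that remains after removing an `ε`-neighbourhood. -/
theorem exists_cut (hp : 1 ≤ p) (hγ : γ.IsPositivelyOriented) (s₀ : ℝ) :
    ∃ sm sp : ℝ → ℝ, Tendsto sm (𝓝[>] 0) (𝓝[<] 0) ∧ Tendsto sp (𝓝[>] 0) (𝓝[>] 0) ∧
      (∀ᶠ ε in 𝓝[>] 0, ‖γ.toFun (s₀ + sm ε) - γ.toFun s₀‖ = ε ∧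
        ‖γ.toFun (s₀ + sp ε) - γ.toFun s₀‖ = ε ∧
        (∀ s ∈ uIcc (-(1 / 2)) (sm ε), γ.toFun (s₀ + s) ≠ γ.toFun s₀) ∧
        (∀ s ∈ uIcc (sp ε) (1 / 2), γ.toFun (s₀ + s) ≠ γ.toFun s₀) ∧
        ∀ f : ℝ → ℂ, Function.Periodic f 1 → ContinuousOn f {s | γ.toFun s ≠ γ.toFun s₀} →
          ∫ s in γ.cutParams (γ.toFun s₀) ε, f s =
            (∫ s in (-(1 / 2))..sm ε, f (s₀ + s)) + ∫ s in sp ε..(1 / 2), f (s₀ + s)) ∧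
      Tendsto (fun ε =>
        (∫ s in (-(1 / 2))..sm ε, deriv γ.toFun (s₀ + s) / (γ.toFun (s₀ + s) - γ.toFun s₀)) +
        ∫ s in sp ε..(1 / 2), deriv γ.toFun (s₀ + s) / (γ.toFun (s₀ + s) - γ.toFun s₀))
        (𝓝[>] 0) (𝓝 (Real.pi * Complex.I)) := by
  have hγ1 := γ.contDiff_one hp
  set w : ℝ → ℂ := fun s => γ.toFun (s₀ + s) - γ.toFun s₀ with hwdef
  have hw : ContDiff ℝ 1 w := (hγ1.comp (contDiff_const.add contDiff_id)).sub contDiff_const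
  have h0 : w 0 = 0 := by simp [hwdef]
  have hwd : ∀ s, deriv w s = deriv γ.toFun (s₀ + s) := fun s => by
    rw [hwdef, deriv_sub_const, deriv_comp_const_add]
  have hper : Function.Periodic w 1 := fun s => by
    simp only [hwdef]
    rw [← add_assoc, γ.periodic]
  have hT : deriv w 0 ≠ 0 := by
    rw [hwd]
    exact γ.deriv_ne_zero _
  have hne : ∀ s, |s| ≤ 1 / 2 → s ≠ 0 → w s ≠ 0 := fun s h h' =>
    sub_ne_zero.2 (γ.apply_add_ne h h')
  have hN : ∀ z ∉ range w, ∫ s in (-(1 / 2) : ℝ)..(1 / 2), deriv w s / (w s - z) ∈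
      ({0, 2 * Real.pi * Complex.I} : Set ℂ) := by
    intro z hz
    have hz' : z + γ.toFun s₀ ∉ γ.carrier := by
      rintro ⟨s, hs⟩
      refine hz ⟨s - s₀, ?_⟩
      simp [hwdef, hs]
    have hF : Function.Periodic
        (fun s => deriv γ.toFun s / (γ.toFun s - (z + γ.toFun s₀))) 1 := fun s => by
      simp only [γ.periodic s, γ.deriv_periodic s]
    have h := γ.winding_mem hp hγ hz'
    rw [← hF.integral_comp_add_left_eq s₀] at h
    convert h using 1
    refine intervalIntegral.integral_congr fun s _ => ?_
    rw [hwd, show w s - z = γ.toFun (s₀ + s) - (z + γ.toFun s₀) by simp only [hwdef]; ring]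
  obtain ⟨η, hη0, hη1, hη⟩ := exists_forall_norm_deriv_div_sub_one_le hw hT
    (show (0 : ℝ) < 1 / 2 by norm_num)
  obtain ⟨sm, sp, hsm, hsp, hev⟩ := exists_cut_params hw h0 hη0 hη1 hT hη hne
  refine ⟨sm, sp, hsm, hsp, ?_, ?_⟩
  · filter_upwards [hev, self_mem_nhdsWithin] with ε hε hε0
    obtain ⟨h1, h2, h3, h4, h5⟩ := hε
    have hm : -(1 / 2) ≤ sm ε := by linarith [h1.1]
    have hpl : sp ε ≤ 1 / 2 := by linarith [h2.2]
    have hnm : ∀ s ∈ uIcc (-(1 / 2)) (sm ε), γ.toFun (s₀ + s) ≠ γ.toFun s₀ := by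
      intro s hs
      rw [uIcc_of_le hm] at hs
      exact γ.apply_add_ne (abs_le.2 ⟨hs.1, by linarith [hs.2, h1.2]⟩) (by linarith [hs.2, h1.2])
    have hnp : ∀ s ∈ uIcc (sp ε) (1 / 2), γ.toFun (s₀ + s) ≠ γ.toFun s₀ := by
      intro s hs
      rw [uIcc_of_le hpl] at hs
      exact γ.apply_add_ne (abs_le.2 ⟨by linarith [hs.1, h2.1], hs.2⟩) (by linarith [hs.1, h2.1])
    refine ⟨h3, h4, hnm, hnp, fun f hfp hfc => ?_⟩
    -- As an integral of a periodic indicator function over a full period, the cut integral can be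
    -- recentred at `s₀`.
    set A : Set ℝ := {s | ε ≤ ‖γ.toFun s - γ.toFun s₀‖} with hA
    have hAm : MeasurableSet A := (isClosed_le continuous_const
      (hγ1.continuous.sub continuous_const).norm).measurableSet
    have hip : Function.Periodic (A.indicator f) 1 := fun s => by
      simp only [indicator, hA, mem_ofPred_eq, γ.periodic s, hfp s]
    have hcut : γ.cutParams (γ.toFun s₀) ε = Ico 0 1 ∩ A := rfl
    rw [hcut, ← setIntegral_indicator hAm, integral_Ico_eq_integral_Ioc,
      ← intervalIntegral.integral_of_le zero_le_one, ← hip.integral_comp_add_left_eq s₀,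
      intervalIntegral.integral_of_le (by norm_num), ← integral_Icc_eq_integral_Ioc,
      intervalIntegral.integral_of_le hm, intervalIntegral.integral_of_le hpl,
      ← integral_Icc_eq_integral_Ioc, ← integral_Icc_eq_integral_Ioc]
    have hB : ∀ s, A.indicator f (s₀ + s) = {s | ε ≤ ‖w s‖}.indicator (fun s => f (s₀ + s)) s :=
      fun s => rfl
    simp only [hB]
    rw [setIntegral_indicator (isClosed_le continuous_const hw.continuous.norm).measurableSet]
    have hset : Icc (-(1 / 2) : ℝ) (1 / 2) ∩ {s | ε ≤ ‖w s‖} =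
        Icc (-(1 / 2)) (sm ε) ∪ Icc (sp ε) (1 / 2) := by
      ext s
      simp only [mem_inter_iff, mem_union, mem_Icc, mem_ofPred_eq]
      constructor
      · rintro ⟨h6, h7⟩
        rcases (h5 s (abs_le.2 h6)).1 h7 with h | h
        · exact Or.inl ⟨h6.1, h⟩
        · exact Or.inr ⟨h, h6.2⟩
      · rintro (⟨h6, h7⟩ | ⟨h6, h7⟩)
        · have h8 : -(1 / 2) ≤ s ∧ s ≤ 1 / 2 := ⟨h6, by linarith [h1.2]⟩
          exact ⟨h8, (h5 s (abs_le.2 h8)).2 (Or.inl h7)⟩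
        · have h8 : -(1 / 2) ≤ s ∧ s ≤ 1 / 2 := ⟨by linarith [h2.1], h7⟩
          exact ⟨h8, (h5 s (abs_le.2 h8)).2 (Or.inr h6)⟩
    have hint : ∀ a b : ℝ, a ≤ b → (∀ s ∈ uIcc a b, γ.toFun (s₀ + s) ≠ γ.toFun s₀) →
        IntegrableOn (fun s => f (s₀ + s)) (Icc a b) := fun a b hab h =>
      ContinuousOn.integrableOn_Icc (hfc.comp (by fun_prop) fun s hs =>
        h s (by rwa [uIcc_of_le hab]))
    rw [hset, setIntegral_union _ measurableSet_Icc (hint _ _ hm hnm) (hint _ _ hpl hnp)]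
    refine Set.disjoint_left.2 fun s h6 h7 => ?_
    linarith [h6.2, h7.1, h1.2, h2.1]
  · have h := tendsto_principal_value hw h0 hper hη0 hη1 hT hη hne hN hsm hsp
      (hev.mono fun ε hε => ⟨hε.1, hε.2.1, by rw [hε.2.2.1, hε.2.2.2.1]⟩)
    simpa only [hwd] using h

/-! ### Hypersingular integrals of analytic functions -/

variable {γ}

theorem hyperIntegrand_periodic (k : ℕ) (φ : ℂ → ℂ) (t : ℂ) :
    Function.Periodic (γ.hyperIntegrand k φ t) 1 := fun s => by
  simp only [hyperIntegrand, γ.periodic s, γ.deriv_periodic s]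

theorem continuousOn_hyperIntegrand (hp : 1 ≤ p) {φ : ℂ → ℂ}
    (hφ : Continuous fun s => φ (γ.toFun s)) (k : ℕ) (t : ℂ) :
    ContinuousOn (γ.hyperIntegrand k φ t) {s | γ.toFun s ≠ t} :=
  (hφ.continuousOn.div (((γ.contDiff_one hp).continuous.sub continuous_const).pow k).continuousOn
    fun _ hs => pow_ne_zero k (sub_ne_zero.2 hs)).mul
    ((γ.contDiff_one hp).continuous_deriv le_rfl).continuousOn

theorem hasHypersingularIntegral_congr {k : ℕ} {φ ψ : ℂ → ℂ} {t I : ℂ}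
    (h : ∀ z ∈ γ.carrier, φ z = ψ z) (hφ : γ.HasHypersingularIntegral k φ t I) :
    γ.HasHypersingularIntegral k ψ t I := by
  have : γ.hyperIntegrand k ψ t = γ.hyperIntegrand k φ t := by
    funext s
    rw [hyperIntegrand, hyperIntegrand, h _ ⟨s, rfl⟩]
  rwa [HasHypersingularIntegral, this]

/-- The principal value of `∫ dτ / (τ - t)` is `πi`. -/
theorem hasHypersingularIntegral_one_one (hp : 1 ≤ p) (hγ : γ.IsPositivelyOriented) (s₀ : ℝ) :
    γ.HasHypersingularIntegral 1 (fun _ => 1) (γ.toFun s₀) (Real.pi * Complex.I) := by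
  refine ⟨fun ε hε => γ.integrableOn_hyperIntegrand hp continuous_const 1 _ hε, 0,
    Submodule.zero_mem _, ?_⟩
  obtain ⟨sm, sp, hsm, hsp, hev, hlim⟩ := γ.exists_cut hp hγ s₀
  refine hlim.congr' ?_
  filter_upwards [hev] with ε hε
  rw [hε.2.2.2.2 _ (hyperIntegrand_periodic 1 _ _)
    (continuousOn_hyperIntegrand hp continuous_const 1 _)]
  simp [hyperIntegrand, div_eq_inv_mul]

/-- The hypersingular integral of `1 / (τ - t) ^ (n + 1)` vanishes for `n ≥ 1`. -/
theorem hasHypersingularIntegral_one_of_ne_zero (hγ : γ.IsPositivelyOriented) {n : ℕ} (hn : n ≠ 0)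
    (hnp : n + 1 ≤ p) (s₀ : ℝ) :
    γ.HasHypersingularIntegral (n + 1) (fun _ => 1) (γ.toFun s₀) 0 := by
  have hp : 1 ≤ p := by omega
  refine ⟨fun ε hε => γ.integrableOn_hyperIntegrand hp continuous_const _ _ hε, ?_⟩
  obtain ⟨sm, sp, hsm, hsp, hev, -⟩ := γ.exists_cut hp hγ s₀
  set w : ℝ → ℂ := fun s => γ.toFun (s₀ + s) - γ.toFun s₀ with hwdef
  have hw : ContDiff ℝ (n + 1 : ℕ) w :=
    ((γ.contDiff.of_le (by exact_mod_cast hnp)).comp (contDiff_const.add contDiff_id)).sub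
      contDiff_const
  have h0 : w 0 = 0 := by simp [hwdef]
  have hwd : ∀ s, HasDerivAt w (deriv γ.toFun (s₀ + s)) s := fun s => by
    have h1 := (((γ.contDiff_one hp).differentiable one_ne_zero) (s₀ + s)).hasDerivAt
    exact (h1.comp_const_add s₀ s).sub_const _
  have hT : deriv w 0 ≠ 0 := by
    rw [(hwd 0).deriv]
    exact γ.deriv_ne_zero _
  -- The two arcs meet at the parameters `±1/2`, so the antiderivative leaves only the end points at
  -- distance `ε`.
  have hhalf : w (-(1 / 2)) = w (1 / 2) := by
    have := γ.periodic (s₀ + -(1 / 2))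
    simp only [hwdef]
    rw [← this]
    congr 2
    ring
  obtain ⟨ξ, hξ, hlim⟩ := exists_tendsto_inv_pow_sub_inv_pow hn hw h0 hT hsm hsp
    (hev.mono fun ε hε => ⟨hε.1, hε.2.1⟩)
  have hn' : (n : ℂ) ≠ 0 := by exact_mod_cast hn
  refine ⟨Polynomial.C (-(n : ℂ)⁻¹) * ξ, ?_, ?_⟩
  · rw [← Polynomial.smul_eq_C_mul]
    exact Submodule.smul_mem _ _ hξ
  have hanti : ∀ a b : ℝ, (∀ s ∈ uIcc a b, γ.toFun (s₀ + s) ≠ γ.toFun s₀) →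
      ∫ s in a..b, γ.hyperIntegrand (n + 1) (fun _ => 1) (γ.toFun s₀) (s₀ + s) =
        -(n : ℂ)⁻¹ * (w b ^ n)⁻¹ - -(n : ℂ)⁻¹ * (w a ^ n)⁻¹ := by
    intro a b hab
    refine intervalIntegral.integral_eq_sub_of_hasDerivAt
      (f := fun s => -(n : ℂ)⁻¹ * (w s ^ n)⁻¹) (fun s hs => ?_) ?_
    · have hws : w s ≠ 0 := sub_ne_zero.2 (hab s hs)
      have h1 := (((hwd s).pow n).inv (pow_ne_zero n hws)).const_mul (-(n : ℂ)⁻¹)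
      refine h1.congr_deriv ?_
      rw [hyperIntegrand]
      change _ = 1 / w s ^ (n + 1) * deriv γ.toFun (s₀ + s)
      obtain ⟨m, rfl⟩ := Nat.exists_eq_succ_of_ne_zero hn
      simp only [Pi.pow_apply, Nat.succ_eq_add_one, Nat.add_sub_cancel] at hn' ⊢
      field_simp
      ring
    · exact ((continuousOn_hyperIntegrand hp continuous_const (n + 1) _).comp (by fun_prop)
        fun s hs => hab s hs).intervalIntegrable
  have hlim' := hlim.const_mul (-(n : ℂ)⁻¹)
  rw [mul_zero] at hlim'
  refine hlim'.congr' ?_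
  filter_upwards [hev] with ε hε
  rw [hε.2.2.2.2 _ (hyperIntegrand_periodic (n + 1) _ _)
    (continuousOn_hyperIntegrand hp continuous_const (n + 1) _), hanti _ _ hε.2.2.1,
    hanti _ _ hε.2.2.2.1, hhalf, Polynomial.eval_mul, Polynomial.eval_C, Nat.add_sub_cancel]
  ring

theorem continuous_comp_of_analyticAt (hp : 1 ≤ p) {φ : ℂ → ℂ}
    (hφ : ∀ z ∈ γ.carrier, AnalyticAt ℂ φ z) : Continuous fun s => φ (γ.toFun s) :=
  continuous_iff_continuousAt.2 fun s =>
    ContinuousAt.comp (hφ _ ⟨s, rfl⟩).continuousAt (γ.contDiff_one hp).continuous.continuousAt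

/-- Base of the recursion on the order: without a singularity the cut integrals tend to the full
contour integral, which is zero by Cauchy's theorem. -/
theorem hasHypersingularIntegral_zero (hp : 1 ≤ p) (hγ : γ.IsPositivelyOriented) {φ : ℂ → ℂ}
    (hφ : ∀ z ∈ γ.carrier ∪ γ.inside, AnalyticAt ℂ φ z) (s₀ : ℝ) :
    γ.HasHypersingularIntegral 0 φ (γ.toFun s₀) 0 := by
  have hφc := continuous_comp_of_analyticAt hp fun z hz => hφ z (Or.inl hz)
  refine ⟨fun ε hε => γ.integrableOn_hyperIntegrand hp hφc _ _ hε, 0, Submodule.zero_mem _, ?_⟩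
  obtain ⟨sm, sp, hsm, hsp, hev, -⟩ := γ.exists_cut hp hγ s₀
  set q : ℝ → ℂ := fun s => γ.hyperIntegrand 0 φ (γ.toFun s₀) (s₀ + s) with hq
  have hqc : Continuous q := by
    have h1 : Continuous fun s => φ (γ.toFun s) * deriv γ.toFun s :=
      hφc.mul ((γ.contDiff_one hp).continuous_deriv le_rfl)
    simp only [hq, hyperIntegrand, pow_zero, div_one]
    exact h1.comp (continuous_const.add continuous_id)
  have hint : ∀ a b : ℝ, IntervalIntegrable q volume a b := fun a b => hqc.intervalIntegrable a b
  have hprim := intervalIntegral.continuous_primitive hint (-(1 / 2))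
  have htot : ∫ s in (-(1 / 2) : ℝ)..(1 / 2), q s = 0 := by
    rw [hq, (hyperIntegrand_periodic 0 φ (γ.toFun s₀)).integral_comp_add_left_eq s₀]
    simp only [hyperIntegrand, pow_zero, div_one]
    refine integral_eq_zero_of_analyticAt (γ.contDiff_one hp) γ.periodic
      (γ.isCompact_carrier hp).isClosed fun z hz => hφ z ?_
    by_cases h : z ∈ γ.carrier
    · exact Or.inl h
    · exact Or.inr ⟨h, hz⟩
  have h1 := (hprim.tendsto 0).comp (hsm.mono_right nhdsWithin_le_nhds)
  have h2 := (hprim.tendsto 0).comp (hsp.mono_right nhdsWithin_le_nhds)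
  have h3 := h1.sub h2
  rw [sub_self] at h3
  refine h3.congr' ?_
  filter_upwards [hev] with ε hε
  rw [hε.2.2.2.2 _ (hyperIntegrand_periodic 0 _ _) (continuousOn_hyperIntegrand hp hφc 0 _)]
  have h4 := intervalIntegral.integral_add_adjacent_intervals (hint (-(1 / 2)) (sp ε))
    (hint (sp ε) (1 / 2))
  rw [htot] at h4
  simp only [Function.comp, Polynomial.eval_zero, zero_div, add_zero]
  linear_combination -h4

/-- Splitting off the value at the singular point raises the order of the singularity by one. -/
theorem HasHypersingularIntegral.add_sub_mul (hp : 1 ≤ p) {k : ℕ} {φ ψ : ℂ → ℂ} {t c I J : ℂ}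
    (hφ : Continuous fun s => φ (γ.toFun s))
    (hI : γ.HasHypersingularIntegral (k + 1) (fun _ => 1) t I)
    (hJ : γ.HasHypersingularIntegral k ψ t J) (h : ∀ z ∈ γ.carrier, φ z = c + (z - t) * ψ z) :
    γ.HasHypersingularIntegral (k + 1) φ t (c * I + J) := by
  obtain ⟨hI, ξ, hξ, hξl⟩ := hI
  obtain ⟨hJ, ζ, hζ, hζl⟩ := hJ
  -- The factor `X` compensates for the extra power of `ε` in the denominator. For `k = 0` there is
  -- no extra power, as `0 - 1 = 0`, but then `ζ = 0`.
  refine ⟨fun ε hε => γ.integrableOn_hyperIntegrand hp hφ _ _ hε,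
    Polynomial.C c * ξ + Polynomial.X * ζ, Submodule.add_mem _ ?_ ?_, ?_⟩
  · rw [← Polynomial.smul_eq_C_mul]
    exact Submodule.smul_mem _ _ hξ
  · rw [Polynomial.mem_degreeLT] at hζ ⊢
    rcases eq_or_ne ζ 0 with h0 | h0
    · rw [h0, mul_zero, Polynomial.degree_zero]
      exact WithBot.bot_lt_coe _
    · rw [Polynomial.degree_mul, Polynomial.degree_X]
      rw [Polynomial.degree_eq_natDegree h0] at hζ ⊢
      norm_cast at hζ ⊢
      omega
  · refine ((hξl.const_mul c).add hζl).congr' ?_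
    filter_upwards [self_mem_nhdsWithin] with ε hε
    have hε' : (ε : ℂ) ≠ 0 := by exact_mod_cast ne_of_gt hε
    have hsum : ∫ s in γ.cutParams t ε, γ.hyperIntegrand (k + 1) φ t s =
        c * (∫ s in γ.cutParams t ε, γ.hyperIntegrand (k + 1) (fun _ => 1) t s) +
          ∫ s in γ.cutParams t ε, γ.hyperIntegrand k ψ t s := by
      rw [← integral_const_mul, ← integral_add ((hI ε hε).const_mul c) (hJ ε hε)]
      refine setIntegral_congr_fun (γ.measurableSet_cutParams hp t ε) fun s hs => ?_
      have hne : γ.toFun s - t ≠ 0 := norm_pos_iff.1 (lt_of_lt_of_le hε hs.2)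
      simp only [hyperIntegrand]
      rw [h _ ⟨s, rfl⟩]
      field_simp
      ring
    rw [hsum, Polynomial.eval_add, Polynomial.eval_mul, Polynomial.eval_mul, Polynomial.eval_C,
      Polynomial.eval_X, Nat.add_sub_cancel]
    rcases k with _ | k
    · have h0 : ζ = 0 := by
        rw [Polynomial.mem_degreeLT] at hζ
        exact Polynomial.degree_eq_bot.1 (by simpa using hζ)
      simp [h0]
      ring
    · rw [Nat.add_sub_cancel]
      field_simp
      ring

/-- At `z = t` this is the removable singularity theorem. -/
theorem _root_.AnalyticAt.dslope {φ : ℂ → ℂ} {t z : ℂ} (hz : AnalyticAt ℂ φ z)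
    (ht : AnalyticAt ℂ φ t) : AnalyticAt ℂ (dslope φ t) z := by
  set U : Set ℂ := {z | AnalyticAt ℂ φ z}
  have hU : IsOpen U := isOpen_analyticAt ℂ φ
  have hd : DifferentiableOn ℂ φ U := fun z hz =>
    (AnalyticAt.differentiableAt hz).differentiableWithinAt
  exact ((Complex.differentiableOn_dslope (hU.mem_nhds ht)).2 hd).analyticAt (hU.mem_nhds hz)

/-- The hypersingular integral of an analytic function, in terms of iterated slopes. -/
theorem hasHypersingularIntegral_dslope (hγ : γ.IsPositivelyOriented) (s₀ : ℝ) {k : ℕ} :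
    k + 1 ≤ p → ∀ {φ : ℂ → ℂ}, (∀ z ∈ γ.carrier ∪ γ.inside, AnalyticAt ℂ φ z) →
    γ.HasHypersingularIntegral (k + 1) φ (γ.toFun s₀)
      (Real.pi * Complex.I * (Function.swap dslope (γ.toFun s₀))^[k] φ (γ.toFun s₀)) := by
  have hdec : ∀ (φ : ℂ → ℂ) (z : ℂ),
      φ z = φ (γ.toFun s₀) + (z - γ.toFun s₀) * dslope φ (γ.toFun s₀) z := fun φ z => by
    have := sub_smul_dslope φ (γ.toFun s₀) z
    rw [smul_eq_mul] at this
    rw [this]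
    ring
  have hds : ∀ {φ : ℂ → ℂ}, (∀ z ∈ γ.carrier ∪ γ.inside, AnalyticAt ℂ φ z) →
      ∀ z ∈ γ.carrier ∪ γ.inside, AnalyticAt ℂ (dslope φ (γ.toFun s₀)) z := fun h z hz =>
    (h z hz).dslope (h _ (Or.inl ⟨s₀, rfl⟩))
  induction k with
  | zero =>
    intro hp φ hφ
    have h := HasHypersingularIntegral.add_sub_mul hp
      (continuous_comp_of_analyticAt hp fun z hz => hφ z (Or.inl hz))
      (hasHypersingularIntegral_one_one hp hγ s₀)
      (hasHypersingularIntegral_zero hp hγ (hds hφ) s₀) fun z _ => hdec φ z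
    simpa [mul_comm] using h
  | succ k ih =>
    intro hk φ hφ
    have hp : 1 ≤ p := by omega
    -- The order is at least `2` here, so the split-off constant contributes nothing and the value
    -- is that of the slope.
    have h := HasHypersingularIntegral.add_sub_mul hp
      (continuous_comp_of_analyticAt hp fun z hz => hφ z (Or.inl hz))
      (hasHypersingularIntegral_one_of_ne_zero hγ k.succ_ne_zero hk s₀)
      (ih (by omega) (hds hφ)) fun z _ => hdec φ z
    rw [mul_zero, zero_add] at h
    exact h

/-- Each slope at `t` shifts the Taylor coefficients at `t` by one place, so the constant
coefficient after `k` slopes is the original `k`-th one. -/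
theorem _root_.AnalyticAt.iterate_dslope_self {φ : ℂ → ℂ} {t : ℂ} (h : AnalyticAt ℂ φ t) (k : ℕ) :
    (Function.swap _root_.dslope t)^[k] φ t = iteratedDeriv k φ t / (k.factorial : ℂ) := by
  have h1 := h.hasFPowerSeriesAt
  have h2 := h1.has_fpower_series_iterate_dslope_fslope k
  rw [← h2.coeff_zero 1]
  have h3 := FormalMultilinearSeries.coeff_iterate_fslope
    (p := FormalMultilinearSeries.ofScalars ℂ fun n => iteratedDeriv n φ t / (n.factorial : ℂ)) k 0
  rw [zero_add, FormalMultilinearSeries.coeff_ofScalars] at h3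
  exact h3

/-- The hypersingular integral of order `p` of an analytic function `φ` equals
`πi φ⁽ᵖ⁻¹⁾(t) / (p - 1)!`. -/
theorem hasHypersingularIntegral_iteratedDeriv (hp : 1 ≤ p) (hγ : γ.IsPositivelyOriented) {t : ℂ}
    (ht : t ∈ γ.carrier) {φ : ℂ → ℂ} (hφ : ∀ z ∈ γ.carrier ∪ γ.inside, AnalyticAt ℂ φ z) :
    γ.HasHypersingularIntegral p φ t
      (Real.pi * Complex.I * (iteratedDeriv (p - 1) φ t / ((p - 1).factorial : ℂ))) := by
  obtain ⟨s₀, rfl⟩ := ht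
  have h := hasHypersingularIntegral_dslope hγ s₀ (k := p - 1) (by omega) hφ
  rwa [Nat.sub_add_cancel hp, (hφ _ (Or.inl ⟨s₀, rfl⟩)).iterate_dslope_self] at h

/-! ### Uniqueness of the finite part -/

/-- If `Q = X ^ m * R` with `R(0) ≠ 0`, then `m ≤ n`, and multiplying the quotient by `ε ^ (n - m)`
would force `R(ε) → 0`. -/
theorem _root_.Polynomial.eq_zero_of_tendsto_div_pow {n : ℕ} {Q : Polynomial ℂ}
    (hQ : Q.degree ≤ n)
    (h : Tendsto (fun ε : ℝ => Q.eval (ε : ℂ) / (ε : ℂ) ^ n) (𝓝[>] 0) (𝓝 0)) : Q = 0 := by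
  by_contra hQ0
  obtain ⟨R, hR, hR0⟩ := Polynomial.exists_eq_pow_rootMultiplicity_mul_and_not_dvd Q hQ0 0
  rw [Polynomial.C_0, sub_zero] at hR hR0
  set m := Q.rootMultiplicity 0
  have hmn : m ≤ n := by
    have h1 : m ≤ Q.natDegree := by
      rw [hR, Polynomial.natDegree_mul (pow_ne_zero _ Polynomial.X_ne_zero)
        (by rintro rfl; simp at hR0), Polynomial.natDegree_X_pow]
      exact Nat.le_add_right _ _
    exact h1.trans (Polynomial.natDegree_le_iff_degree_le.2 hQ)
  have hε : Tendsto (fun ε : ℝ => (ε : ℂ)) (𝓝[>] 0) (𝓝 0) := by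
    have := Complex.continuous_ofReal.tendsto 0
    rw [Complex.ofReal_zero] at this
    exact this.mono_left nhdsWithin_le_nhds
  have h1 : Tendsto (fun ε : ℝ => R.eval (ε : ℂ)) (𝓝[>] 0) (𝓝 0) := by
    have h2 := h.mul (hε.pow (n - m))
    rw [zero_mul] at h2
    refine h2.congr' ?_
    filter_upwards [self_mem_nhdsWithin] with ε hε0
    have hε' : (ε : ℂ) ≠ 0 := by exact_mod_cast ne_of_gt hε0
    rw [hR, Polynomial.eval_mul, Polynomial.eval_pow, Polynomial.eval_X,
      ← Nat.add_sub_cancel' hmn, pow_add, Nat.add_sub_cancel_left]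
    field_simp
  have h2 := tendsto_nhds_unique h1 ((R.continuous.tendsto 0).comp hε)
  exact hR0 (Polynomial.X_dvd_iff.2 (by rw [Polynomial.coeff_zero_eq_eval_zero]; exact h2.symm))

/-- The value of a hypersingular integral is unique. -/
theorem HasHypersingularIntegral.unique {k : ℕ} {φ : ℂ → ℂ} {t I J : ℂ}
    (hI : γ.HasHypersingularIntegral k φ t I) (hJ : γ.HasHypersingularIntegral k φ t J) :
    I = J := by
  obtain ⟨-, ξ, hξ, hξl⟩ := hI
  obtain ⟨-, ζ, hζ, hζl⟩ := hJ
  have hsub := Submodule.sub_mem _ hξ hζ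
  rw [Polynomial.mem_degreeLT] at hsub
  have h := hξl.sub hζl
  set n := k - 1
  -- Subtracting the two limits removes the integrals. As `ξ - ζ` has degree below `n`, the
  -- coefficient of `X ^ n` in this polynomial is `-(I - J)`.
  have hQ := Polynomial.eq_zero_of_tendsto_div_pow (n := n)
    (Q := ξ - ζ - Polynomial.C (I - J) * Polynomial.X ^ n)
    ((Polynomial.degree_sub_le _ _).trans (max_le hsub.le (Polynomial.degree_C_mul_X_pow_le _ _)))
    (by
      have h1 := h.sub_const (I - J)
      rw [sub_self] at h1
      refine h1.congr' ?_
      filter_upwards [self_mem_nhdsWithin] with ε hε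
      have hε' : (ε : ℂ) ≠ 0 := by exact_mod_cast ne_of_gt hε
      simp only [Polynomial.eval_sub, Polynomial.eval_mul, Polynomial.eval_C, Polynomial.eval_pow,
        Polynomial.eval_X]
      field_simp
      ring)
  have hc := congrArg (fun Q => Polynomial.coeff Q n) hQ
  simp only [Polynomial.coeff_sub (ξ - ζ), Polynomial.coeff_C_mul, Polynomial.coeff_X_pow_self,
    Polynomial.coeff_eq_zero_of_degree_lt hsub, Polynomial.coeff_zero, mul_one, zero_sub,
    neg_eq_zero] at hc
  exact sub_eq_zero.1 hc

end ClosedContour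

/-! ### Analyticity of partial derivatives and the identity theorem -/

/-- One partial derivative is the total derivative applied to `(0, 1)`, hence jointly analytic; the
general case follows by induction over all `x`. -/
theorem AnalyticAt.iteratedDeriv_snd {n : ℕ} : ∀ {x : ℂ × ℂ → ℂ} {q : ℂ × ℂ}, AnalyticAt ℂ x q →
    AnalyticAt ℂ (fun q => iteratedDeriv n (fun w => x (q.1, w)) q.2) q := by
  induction n with
  | zero =>
    intro x q hx
    simpa using hx
  | succ n ih =>
    intro x q hx
    have hD : AnalyticAt ℂ (fun q => deriv (fun w => x (q.1, w)) q.2) q := by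
      have h1 : AnalyticAt ℂ (fun q => fderiv ℂ x q (0, 1)) q :=
        ((ContinuousLinearMap.apply ℂ ℂ ((0, 1) : ℂ × ℂ)).analyticAt _).comp hx.fderiv
      refine h1.congr ?_
      filter_upwards [hx.eventually_analyticAt] with r hr
      have h2 : HasDerivAt (fun w : ℂ => (r.1, w)) ((0, 1) : ℂ × ℂ) r.2 :=
        (hasDerivAt_const _ _).prodMk (hasDerivAt_id _)
      exact (hr.differentiableAt.hasFDerivAt.comp_hasDerivAt r.2 h2).deriv.symm
    simp only [iteratedDeriv_succ']
    exact ih hD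

theorem AnalyticAt.iteratedDeriv_fst {n : ℕ} {x : ℂ × ℂ → ℂ} {q : ℂ × ℂ} (hx : AnalyticAt ℂ x q) :
    AnalyticAt ℂ (fun q => iteratedDeriv n (fun z => x (z, q.2)) q.1) q := by
  have hswap : ∀ q : ℂ × ℂ, AnalyticAt ℂ (Prod.swap : ℂ × ℂ → ℂ × ℂ) q := fun q =>
    analyticAt_snd.prod analyticAt_fst
  have h1 : AnalyticAt ℂ (fun r : ℂ × ℂ => x r.swap) q.swap :=
    AnalyticAt.fun_comp (by rwa [Prod.swap_swap]) (hswap _)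
  exact (AnalyticAt.iteratedDeriv_snd (n := n) h1).fun_comp (hswap q)

namespace ClosedContour

variable {p : ℕ} {γ : ClosedContour p}

/-- An analytic function that vanishes on a contour vanishes on every connected set containing the
contour. -/
theorem eqOn_zero_of_analyticOnNhd (hp : 1 ≤ p) {G : Set ℂ} (hG : IsPreconnected G)
    (hγG : γ.carrier ⊆ G) {r : ℂ → ℂ} (hr : AnalyticOnNhd ℂ r G) (h0 : ∀ z ∈ γ.carrier, r z = 0) :
    ∀ z ∈ G, r z = 0 := by
  refine hr.eqOn_zero_of_preconnected_of_frequently_eq_zero hG (hγG ⟨0, rfl⟩) ?_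
  -- Injectivity makes `γ 0` an accumulation point of the contour.
  have hlim : Tendsto γ.toFun (𝓝[>] 0) (𝓝[≠] γ.toFun 0) := by
    refine tendsto_nhdsWithin_iff.2
      ⟨((γ.contDiff_one hp).continuous.tendsto 0).mono_left nhdsWithin_le_nhds, ?_⟩
    filter_upwards [self_mem_nhdsWithin,
      nhdsWithin_le_nhds (Iio_mem_nhds (show (0 : ℝ) < 1 / 2 by norm_num))] with s hs hs'
    have h := γ.apply_add_ne (s₀ := 0) (s := s)
      (by rw [abs_of_pos hs]; exact le_of_lt hs') (ne_of_gt hs)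
    rwa [zero_add] at h
  exact hlim.frequently (Eventually.of_forall fun s => h0 _ ⟨s, rfl⟩).frequently

end ClosedContour

/-! ### From the integral equation to the differential equation -/

section

variable {p : ℕ} {γ₁ γ₂ : ClosedContour p} {x : ℂ × ℂ → ℂ} {t₁ t₂ : ℂ}

/-- The bihypersingular integral of an analytic function. -/
theorem hasBihypersingularIntegral_iff (hp : 1 ≤ p)
    (hγ₁ : γ₁.IsPositivelyOriented) (hγ₂ : γ₂.IsPositivelyOriented)
    (ht₁ : t₁ ∈ γ₁.carrier) (ht₂ : t₂ ∈ γ₂.carrier)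
    (hx : AnalyticOnNhd ℂ x ((γ₁.carrier ∪ γ₁.inside) ×ˢ (γ₂.carrier ∪ γ₂.inside))) {I : ℂ} :
    HasBihypersingularIntegral γ₁ γ₂ p x t₁ t₂ I ↔
      I = -((Real.pi : ℂ) ^ 2 * (iteratedDeriv (p - 1) (fun z₁ => iteratedDeriv (p - 1)
        (fun z₂ => x (z₁, z₂)) t₂) t₁ / ((p - 1).factorial : ℂ) ^ 2)) := by
  set D : ℂ → ℂ := fun z₁ => iteratedDeriv (p - 1) (fun z₂ => x (z₁, z₂)) t₂ with hD
  set H₀ : ℂ → ℂ := fun z₁ => Real.pi * Complex.I / ((p - 1).factorial : ℂ) * D z₁ with hH₀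
  have hinner : ∀ τ₁ ∈ γ₁.carrier,
      γ₂.HasHypersingularIntegral p (fun τ₂ => x (τ₁, τ₂)) t₂ (H₀ τ₁) := by
    intro τ₁ hτ₁
    have h := ClosedContour.hasHypersingularIntegral_iteratedDeriv hp hγ₂ ht₂
      (φ := fun τ₂ => x (τ₁, τ₂)) fun z hz => (hx (τ₁, z) ⟨Or.inl hτ₁, hz⟩).along_snd
    convert h using 1
    simp only [hH₀, hD]
    ring
  have hDa : ∀ z ∈ γ₁.carrier ∪ γ₁.inside, AnalyticAt ℂ D z := fun z hz =>
    (AnalyticAt.iteratedDeriv_snd (n := p - 1) (hx (z, t₂) ⟨hz, Or.inl ht₂⟩)).along_fst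
  have houter := ClosedContour.hasHypersingularIntegral_iteratedDeriv hp hγ₁ ht₁ (φ := H₀)
    fun z hz => analyticAt_const.mul (hDa z hz)
  have hval : Real.pi * Complex.I * (iteratedDeriv (p - 1) H₀ t₁ / ((p - 1).factorial : ℂ)) =
      -((Real.pi : ℂ) ^ 2 * (iteratedDeriv (p - 1) D t₁ / ((p - 1).factorial : ℂ) ^ 2)) := by
    rw [hH₀, iteratedDeriv_const_mul_field]
    have hf : ((p - 1).factorial : ℂ) ≠ 0 := by exact_mod_cast (p - 1).factorial_ne_zero
    field_simp
    rw [Complex.I_sq]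
    ring
  rw [hval] at houter
  constructor
  · rintro ⟨H, hH, hI⟩
    -- Uniqueness of the inner integrals determines `H` on `γ₁` only, and the outer integral sees no
    -- other values.
    refine ClosedContour.HasHypersingularIntegral.unique
      (ClosedContour.hasHypersingularIntegral_congr (fun z hz => ?_) hI) houter
    exact (hH z hz).unique (hinner z hz)
  · rintro rfl
    exact ⟨H₀, hinner, houter⟩

/-- Uniqueness identifies any admissible integrals with their derivative values, and existence
supplies them for the converse. The factors `πi` cancel, and `-1/π²` meets `(πi)² = -π²`. -/
theorem solvesBihypersingularEquation_iff (hp : 1 ≤ p)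
    (hγ₁ : γ₁.IsPositivelyOriented) (hγ₂ : γ₂.IsPositivelyOriented) (a b c d f : ℂ × ℂ → ℂ)
    (hx : AnalyticOnNhd ℂ x ((γ₁.carrier ∪ γ₁.inside) ×ˢ (γ₂.carrier ∪ γ₂.inside))) :
    SolvesBihypersingularEquation γ₁ γ₂ p a b c d f x ↔
      SolvesPDEOn (γ₁.carrier ×ˢ γ₂.carrier) p a b c d f x := by
  have hπ : (Real.pi : ℂ) ≠ 0 := by exact_mod_cast Real.pi_ne_zero
  have hf : ((p - 1).factorial : ℂ) ≠ 0 := by exact_mod_cast (p - 1).factorial_ne_zero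
  have key : ∀ t₁ ∈ γ₁.carrier, ∀ t₂ ∈ γ₂.carrier,
      ((∃ I₁ I₂ I₁₂ : ℂ, γ₁.HasHypersingularIntegral p (fun τ₁ => x (τ₁, t₂)) t₁ I₁ ∧
        γ₂.HasHypersingularIntegral p (fun τ₂ => x (t₁, τ₂)) t₂ I₂ ∧
        HasBihypersingularIntegral γ₁ γ₂ p x t₁ t₂ I₁₂ ∧
        a (t₁, t₂) * x (t₁, t₂) + b (t₁, t₂) / (Real.pi * Complex.I) * I₁
          + c (t₁, t₂) / (Real.pi * Complex.I) * I₂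
          - d (t₁, t₂) / (Real.pi : ℂ) ^ 2 * I₁₂ = f (t₁, t₂)) ↔
      a (t₁, t₂) * x (t₁, t₂)
        + b (t₁, t₂) / ((p - 1).factorial : ℂ) *
          iteratedDeriv (p - 1) (fun z₁ => x (z₁, t₂)) t₁
        + c (t₁, t₂) / ((p - 1).factorial : ℂ) *
          iteratedDeriv (p - 1) (fun z₂ => x (t₁, z₂)) t₂
        + d (t₁, t₂) / ((p - 1).factorial : ℂ) ^ 2 *
          iteratedDeriv (p - 1) (fun z₁ => iteratedDeriv (p - 1) (fun z₂ => x (z₁, z₂)) t₂) t₁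
        = f (t₁, t₂)) := by
    intro t₁ ht₁ t₂ ht₂
    have h1 := ClosedContour.hasHypersingularIntegral_iteratedDeriv hp hγ₁ ht₁
      (φ := fun τ₁ => x (τ₁, t₂)) fun z hz => (hx (z, t₂) ⟨hz, Or.inl ht₂⟩).along_fst
    have h2 := ClosedContour.hasHypersingularIntegral_iteratedDeriv hp hγ₂ ht₂
      (φ := fun τ₂ => x (t₁, τ₂)) fun z hz => (hx (t₁, z) ⟨Or.inl ht₁, hz⟩).along_snd
    have h12 := fun I => hasBihypersingularIntegral_iff hp hγ₁ hγ₂ ht₁ ht₂ hx (I := I)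
    constructor
    · rintro ⟨I₁, I₂, I₁₂, hI₁, hI₂, hI₁₂, heq⟩
      rw [hI₁.unique h1, hI₂.unique h2, (h12 _).1 hI₁₂] at heq
      rw [← heq]
      field_simp
      ring
    · intro heq
      refine ⟨_, _, _, h1, h2, (h12 _).2 rfl, ?_⟩
      rw [← heq]
      field_simp
      ring
  constructor
  · rintro h ⟨t₁, t₂⟩ ⟨ht₁, ht₂⟩
    exact (key t₁ ht₁ t₂ ht₂).1 (h t₁ ht₁ t₂ ht₂)
  · intro h t₁ ht₁ t₂ ht₂
    exact (key t₁ ht₁ t₂ ht₂).2 (h (t₁, t₂) ⟨ht₁, ht₂⟩)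

end

/-- By the identity theorem the differential equation carries over from `γ₁ × γ₂` to `G₁ × G₂`. -/
theorem solvesPDEOn_carrier_iff {p : ℕ} (hp : 1 ≤ p) {γ₁ γ₂ : ClosedContour p} {G₁ G₂ : Set ℂ}
    (hG₁ : IsPreconnected G₁) (hG₂ : IsPreconnected G₂)
    (hγG₁ : γ₁.carrier ⊆ G₁) (hγG₂ : γ₂.carrier ⊆ G₂) {a b c d f x : ℂ × ℂ → ℂ}
    (ha : AnalyticOnNhd ℂ a (G₁ ×ˢ G₂)) (hb : AnalyticOnNhd ℂ b (G₁ ×ˢ G₂))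
    (hc : AnalyticOnNhd ℂ c (G₁ ×ˢ G₂)) (hd : AnalyticOnNhd ℂ d (G₁ ×ˢ G₂))
    (hf : AnalyticOnNhd ℂ f (G₁ ×ˢ G₂)) (hx : AnalyticOnNhd ℂ x (G₁ ×ˢ G₂)) :
    SolvesPDEOn (γ₁.carrier ×ˢ γ₂.carrier) p a b c d f x ↔
      SolvesPDEOn (G₁ ×ˢ G₂) p a b c d f x := by
  refine ⟨fun h => ?_, fun h t ht => h t ⟨hγG₁ ht.1, hγG₂ ht.2⟩⟩
  set R : ℂ × ℂ → ℂ := fun t => a t * x t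
      + b t / ((p - 1).factorial : ℂ) * iteratedDeriv (p - 1) (fun z₁ => x (z₁, t.2)) t.1
      + c t / ((p - 1).factorial : ℂ) * iteratedDeriv (p - 1) (fun z₂ => x (t.1, z₂)) t.2
      + d t / ((p - 1).factorial : ℂ) ^ 2 *
          iteratedDeriv (p - 1) (fun z₁ => iteratedDeriv (p - 1) (fun z₂ => x (z₁, z₂)) t.2) t.1
      - f t with hR
  have hn : ((p - 1).factorial : ℂ) ≠ 0 := by exact_mod_cast (p - 1).factorial_ne_zero
  have hRa : AnalyticOnNhd ℂ R (G₁ ×ˢ G₂) := fun t ht =>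
    ((((ha t ht).mul (hx t ht)).add
      (((hb t ht).div analyticAt_const hn).mul (hx t ht).iteratedDeriv_fst)).add
      (((hc t ht).div analyticAt_const hn).mul (hx t ht).iteratedDeriv_snd)).add
      (((hd t ht).div analyticAt_const (pow_ne_zero 2 hn)).mul
        (AnalyticAt.iteratedDeriv_fst (hx t ht).iteratedDeriv_snd)) |>.sub (hf t ht)
  -- First `t₁` moves from `γ₁` to `G₁` with `t₂` kept on `γ₂`; then `t₂` moves to `G₂` for each
  -- fixed `t₁ ∈ G₁`.
  have h1 : ∀ t₂ ∈ γ₂.carrier, ∀ t₁ ∈ G₁, R (t₁, t₂) = 0 := fun t₂ ht₂ =>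
    ClosedContour.eqOn_zero_of_analyticOnNhd hp hG₁ hγG₁
      (fun z hz => (hRa (z, t₂) ⟨hz, hγG₂ ht₂⟩).along_fst)
      fun z hz => sub_eq_zero.2 (h (z, t₂) ⟨hz, ht₂⟩)
  rintro ⟨t₁, t₂⟩ ⟨ht₁, ht₂⟩
  exact sub_eq_zero.1 (ClosedContour.eqOn_zero_of_analyticOnNhd hp hG₂ hγG₂
    (r := fun t₂ => R (t₁, t₂)) (fun z hz => (hRa (t₁, z) ⟨ht₁, hz⟩).along_snd)
    (fun z hz => h1 z hz t₁ ht₁) t₂ ht₂)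

theorem mainTheorem6 (p : ℕ) (hp : 1 ≤ p)
    (γ₁ γ₂ : ClosedContour p)
    (hγ₁ : γ₁.IsPositivelyOriented) (hγ₂ : γ₂.IsPositivelyOriented)
    (G₁ G₂ : Set ℂ) (hG₁ : IsPreconnected G₁) (hG₂ : IsPreconnected G₂)
    (hγG₁ : γ₁.carrier ∪ γ₁.inside ⊆ G₁) (hγG₂ : γ₂.carrier ∪ γ₂.inside ⊆ G₂)
    (a b c d f : ℂ × ℂ → ℂ)
    (ha : AnalyticOnNhd ℂ a (G₁ ×ˢ G₂)) (hb : AnalyticOnNhd ℂ b (G₁ ×ˢ G₂))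
    (hc : AnalyticOnNhd ℂ c (G₁ ×ˢ G₂)) (hd : AnalyticOnNhd ℂ d (G₁ ×ˢ G₂))
    (hf : AnalyticOnNhd ℂ f (G₁ ×ˢ G₂))
    (x : ℂ × ℂ → ℂ) (hx : AnalyticOnNhd ℂ x (G₁ ×ˢ G₂)) :
    (SolvesBihypersingularEquation γ₁ γ₂ p a b c d f x ↔
      SolvesPDEOn (γ₁.carrier ×ˢ γ₂.carrier) p a b c d f x) ∧
    (SolvesBihypersingularEquation γ₁ γ₂ p a b c d f x ↔
      SolvesPDEOn (G₁ ×ˢ G₂) p a b c d f x) := by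
  have h := solvesBihypersingularEquation_iff hp hγ₁ hγ₂ a b c d f
    (hx.mono (prod_mono hγG₁ hγG₂))
  exact ⟨h, h.trans (solvesPDEOn_carrier_iff hp hG₁ hG₂
    (subset_union_left.trans hγG₁) (subset_union_left.trans hγG₂) ha hb hc hd hf hx)⟩
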